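/- **Setting.** A transmitter with $L\ge 1$ antennas knows a library of $N$ files of $B$ bits each and serves $K=K_1+K_2\le N$ single-antenna users over the Gaussian channel $y_k=\mathbf h_k^{H}\mathbf x+w_k$, $w_k\sim\mathbb{CN}(0,1)$, under average power constraint $P$. The channel is known everywhere and is in general position: any at most $L$ of the vectors $\mathbf h_k\in\mathbb C^L$ are linearly independent. Each of the $K_1\ge1$ cache-aided users has a cache of $\gamma_1NB$ bits, where $0<\gamma_1<1$ and $K_1\gamma_1$ is an integer; the other $K_2\ge 0$ users have no cache. Caches are filled before the demands and the channel are known; then all users request different files. Delay is the worst case over the demands, measured in units of the time $B/\log_2P$ that one file needs on one link of capacity $\log_2 P$, with error probability vanishing as $B\to\infty$ and in the limit $P\to\infty$. A placement is *uncoded* if every cache stores a subset of the library's bits. In a *linear one-shot scheme* each file is split into equal packets, caches store packets, and in each packet-long slot the transmitter sends a linear combination of (coded) packets with precoding vectors in $\mathbb C^L$; every uncached packet of a requested file is delivered to its user within a single slot, in which all other packets not cached at that user are zero-forced at that user. Its delay is the number of slots divided by the number of packets per file. Put $$T_{K_1}=\frac{K_1(1-\gamma_1)}{1+K_1\gamma_1}.$$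 **Theorem.** (a) Let $K_2\ge (L-1)T_{K_1}$ and $K_2\ge L-1$. Then the delay $$T_{K_1}+\frac{K_2-(L-1)T_{K_1}}{\min\{L,K_2\}}$$ (the fraction is read as $0$ if $K_2=0$) is achievable, by a linear one-shot scheme and, over the Gaussian channel, with uncoded placement. If $L\ge2$ or $T_{K_1}\le K_2$, it is at most $2$ times the delay of any scheme whatsoever (with arbitrary, possibly coded, placement and arbitrary delivery). In all cases, including $L=1$, it is at most $2$ times the delay of any scheme with uncoded placement and arbitrary delivery. (b) Let $K_2\le (L-1)T_{K_1}$, and let $K_1\gamma_1+L\le K_2+K_1(1-\gamma_1)$ (or, if $K_2=0$, only $K_1\gamma_1+L\le K_1$). Then the delay $$\frac{K_2+K_1(1-\gamma_1)}{K_1\gamma_1+L}$$ is achievable, by a linear one-shot scheme and, over the Gaussian channel, with uncoded placement, and it is at most $3$ times the delay of any linear one-shot scheme. In both parts one placement serves all channels in general position, while the gaps hold for each single such channel, even against schemes whose placement is designed for that channel. -/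

import Mathlib

open MeasureTheory ProbabilityTheory Filter

namespace CodedCaching

/-- The users: `Sum.inl i` is the cache-aided user `i`, `Sum.inr j` the cache-less user `j`. -/
abbrev User (K₁ K₂ : ℕ) : Type := Fin K₁ ⊕ Fin K₂

/-- The normalized cache size of each user: `γ₁` for cache-aided users, `0` for cache-less users. -/
def cacheFraction {K₁ K₂ : ℕ} (γ₁ : ℝ) : User K₁ K₂ → ℝ :=
  Sum.elim (fun _ => γ₁) (fun _ => 0)

/-- `T_K = K (1 - γ) / (1 + K γ)`, the single-antenna delay of `K` users with normalized caches `γ`. -/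
noncomputable def singleStreamDelay (K : ℕ) (γ : ℝ) : ℝ :=
  (K : ℝ) * (1 - γ) / (1 + (K : ℝ) * γ)

/-- A channel realization: the vector `h k ∈ ℂ^L` for every user `k`. -/
abbrev Channel (L K₁ K₂ : ℕ) : Type := User K₁ K₂ → Fin L → ℂ

/-- The channels in general position: any (at most) `L` channel vectors are linearly independent. -/
def genericChannels (L K₁ K₂ : ℕ) : Set (Channel L K₁ K₂) :=
  {h | ∀ S : Finset (User K₁ K₂), S.card ≤ L → LinearIndependent ℂ (fun k : S => h k)}

/-- The noiseless output `h_kᴴ x` at user `k` when the antennas send `x`. -/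
noncomputable def chanOut {L K₁ K₂ : ℕ} (h : Channel L K₁ K₂) (k : User K₁ K₂) (x : Fin L → ℂ) : ℂ :=
  ∑ a, star (h k a) * x a

/-! ### Linear one-shot schemes

Every file is split into `F` packets of equal size, every cache stores packets. A time slot is the
time needed to send one packet over one interference-free link, so `H` slots are a delay `H / F`
(in units of the time needed to send one file over such a link). -/

/-- An uncoded placement of packets, `(n, f)` being packet `f` of file `n`, that respects the sizes
of the caches. -/
structure PacketPlacement (K₁ K₂ : ℕ) (γ₁ : ℝ) (N F : ℕ) where
  /-- the packets in the cache of each user -/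
  cache : User K₁ K₂ → Finset (Fin N × Fin F)
  /-- a cache holds at most a fraction `γ₁` (cache-aided) or `0` (cache-less) of the library -/
  card_le : ∀ k, ((cache k).card : ℝ) ≤ cacheFraction γ₁ k * N * F

/-- A linear one-shot delivery in `H` slots. In slot `s` the transmitter sends
`∑ p, beam s p • (symbols of packet p)`. A user served in slot `s` must obtain its packet from its
received signal of this slot alone, by a linear combination with packets in its cache: the wanted packet has
a nonzero coefficient, and every other packet that is not in the cache has coefficient zero. -/
structure LinearDelivery {L K₁ K₂ : ℕ} {γ₁ : ℝ} {N F : ℕ} (Z : PacketPlacement K₁ K₂ γ₁ N F)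
    (h : Channel L K₁ K₂) (d : User K₁ K₂ → Fin N) (H : ℕ) where
  /-- the precoding vector of each packet in each slot -/
  beam : Fin H → Fin N × Fin F → Fin L → ℂ
  /-- the packet of its requested file, if any, that each user obtains in each slot -/
  served : Fin H → User K₁ K₂ → Option (Fin F)
  wanted_ne_zero : ∀ s k f, served s k = some f → chanOut h k (beam s (d k, f)) ≠ 0
  interference_eq_zero : ∀ s k f, served s k = some f →
    ∀ p, p ≠ (d k, f) → p ∉ Z.cache k → chanOut h k (beam s p) = 0
  /-- every packet of the requested file that is not in the cache is delivered -/
  complete : ∀ k f, (d k, f) ∉ Z.cache k → ∃ s, served s k = some f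

/-- The delay `T` is achieved by a linear one-shot scheme: there is one placement with which, for all
channels in `𝓗` and all demands of different files, delivery takes a time at most `T`. -/
def LinearOneShotAchievable {L K₁ K₂ : ℕ} (γ₁ : ℝ) (N : ℕ) (𝓗 : Set (Channel L K₁ K₂)) (T : ℝ) :
    Prop :=
  ∃ F : ℕ, 0 < F ∧ ∃ Z : PacketPlacement K₁ K₂ γ₁ N F,
    ∀ h ∈ 𝓗, ∀ d : User K₁ K₂ → Fin N, Function.Injective d →
      ∃ H : ℕ, (H : ℝ) ≤ T * F ∧ Nonempty (LinearDelivery Z h d H)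

/-! ### Arbitrary schemes over the Gaussian channel -/

/-- A library of `N` files of `B` bits each. -/
abbrev Library (N B : ℕ) : Type := Fin N → Fin B → Bool

/-- An arbitrary (possibly coded) placement: each cache holds a function of the library, of at most
`γ₁ N B` bits at a cache-aided user and of `0` bits at a cache-less user. -/
structure Placement (K₁ K₂ : ℕ) (γ₁ : ℝ) (N B : ℕ) where
  /-- the number of bits in each cache -/
  size : User K₁ K₂ → ℕ
  size_le : ∀ k, (size k : ℝ) ≤ cacheFraction γ₁ k * N * B
  /-- the content of each cache -/
  content : (k : User K₁ K₂) → Library N B → Fin (size k) → Bool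

/-- The placement is uncoded: each cached bit is a fixed bit of the library. -/
def Placement.IsUncoded {K₁ K₂ : ℕ} {γ₁ : ℝ} {N B : ℕ} (Z : Placement K₁ K₂ γ₁ N B) : Prop :=
  ∀ k, ∃ pos : Fin (Z.size k) → Fin N × Fin B, ∀ W i, Z.content k W i = W (pos i).1 (pos i).2

/-- The circularly symmetric complex Gaussian distribution `ℂ𝒩(0, 1)`. -/
noncomputable def complexGaussian : Measure ℂ :=
  ((gaussianReal 0 (1 / 2)).prod (gaussianReal 0 (1 / 2))).map (fun p : ℝ × ℝ => (⟨p.1, p.2⟩ : ℂ))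

/-- Independent `ℂ𝒩(0, 1)` noise over `n` channel uses. -/
noncomputable def noise (n : ℕ) : Measure (Fin n → ℂ) :=
  Measure.pi (fun _ => complexGaussian)

/-- A delivery code with `n` channel uses: an encoder that sees the whole library, and at each user a
measurable decoder that sees the received signal and the content of the cache. -/
structure DeliveryCode {K₁ K₂ : ℕ} {γ₁ : ℝ} {N B : ℕ} (L : ℕ) (Z : Placement K₁ K₂ γ₁ N B)
    (n : ℕ) where
  /-- the transmitted vectors -/
  enc : Library N B → Fin n → Fin L → ℂ
  /-- the estimates of the requested files -/
  dec : (k : User K₁ K₂) → (Fin n → ℂ) → (Fin (Z.size k) → Bool) → Fin B → Bool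
  measurable_dec : ∀ k z, Measurable (fun y => dec k y z)

namespace DeliveryCode

variable {L K₁ K₂ : ℕ} {γ₁ : ℝ} {N B : ℕ} {Z : Placement K₁ K₂ γ₁ N B} {n : ℕ}

/-- The transmitted energy over all channel uses, averaged over a uniformly distributed library. -/
noncomputable def energy (c : DeliveryCode L Z n) : ℝ :=
  (∑ W : Library N B, ∑ s, ∑ a, ‖c.enc W s a‖ ^ 2) / Fintype.card (Library N B)

/-- The received signal `y_k = h_kᴴ x + w` at user `k`. -/
noncomputable def received (c : DeliveryCode L Z n) (h : Channel L K₁ K₂) (k : User K₁ K₂)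
    (W : Library N B) (w : Fin n → ℂ) : Fin n → ℂ :=
  fun s => chanOut h k (c.enc W s) + w s

/-- The probability, over a uniformly distributed library and the noise, that user `k` fails to
recover its requested file. -/
noncomputable def errorProb (c : DeliveryCode L Z n) (h : Channel L K₁ K₂)
    (d : User K₁ K₂ → Fin N) (k : User K₁ K₂) : ℝ :=
  (∑ W : Library N B,
    (noise n).real {w | c.dec k (c.received h k W w) (Z.content k W) ≠ W (d k)})
    / Fintype.card (Library N B)

end DeliveryCode

/-- The delay `T` is achievable with placements from the class `adm`. Delay is measured in
units of the time `B / log₂ P` that one file needs on one link of capacity `log₂ P`. For each `δ > 0`,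
placements can be chosen, before the channel in `𝓗` and the demands are known, such that for each
channel in `𝓗` and all large enough powers `P`, `n ≤ (T + δ) B / log₂ P` channel uses suffice for all
demands of different files, with arbitrarily small probability of error for arbitrarily large files. -/
def AchievableWith {L K₁ K₂ : ℕ} (γ₁ : ℝ) (N : ℕ) (adm : ∀ B, Set (Placement K₁ K₂ γ₁ N B))
    (𝓗 : Set (Channel L K₁ K₂)) (T : ℝ) : Prop :=
  ∀ δ : ℝ, 0 < δ →
    ∃ Z : ℝ → (B : ℕ) → Placement K₁ K₂ γ₁ N B, (∀ P B, Z P B ∈ adm B) ∧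
      ∀ h ∈ 𝓗, ∀ᶠ P : ℝ in atTop, ∀ ε : ℝ, 0 < ε → ∃ᶠ B : ℕ in atTop,
        ∀ d : User K₁ K₂ → Fin N, Function.Injective d →
          ∃ (n : ℕ) (c : DeliveryCode L (Z P B) n),
            (n : ℝ) * Real.logb 2 P ≤ (T + δ) * B ∧
            c.energy ≤ n * P ∧
            ∀ k, c.errorProb h d k ≤ ε

/-- The delay `T` is achievable by some scheme, with no restriction on placement or delivery. -/
def Achievable {L K₁ K₂ : ℕ} (γ₁ : ℝ) (N : ℕ) (𝓗 : Set (Channel L K₁ K₂)) (T : ℝ) : Prop :=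
  AchievableWith γ₁ N (fun _ => Set.univ) 𝓗 T

/-- The delay `T` is achievable by some scheme with uncoded placement (and arbitrary delivery). -/
def UncodedAchievable {L K₁ K₂ : ℕ} (γ₁ : ℝ) (N : ℕ) (𝓗 : Set (Channel L K₁ K₂)) (T : ℝ) : Prop :=
  AchievableWith γ₁ N (fun _ => {Z | Z.IsUncoded}) 𝓗 T

/-- The delay `T_{K₁} + (K₂ - (L - 1) T_{K₁}) / min {L, K₂}`. -/
noncomputable def delayMany (L K₁ K₂ : ℕ) (γ₁ : ℝ) : ℝ :=
  singleStreamDelay K₁ γ₁ +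
    ((K₂ : ℝ) - ((L : ℝ) - 1) * singleStreamDelay K₁ γ₁) / min (L : ℝ) (K₂ : ℝ)

/-- The delay `(K₂ + K₁ (1 - γ₁)) / (K₁ γ₁ + L)`. -/
noncomputable def delayFew (L K₁ K₂ : ℕ) (γ₁ : ℝ) : ℝ :=
  ((K₂ : ℝ) + (K₁ : ℝ) * (1 - γ₁)) / ((K₁ : ℝ) * γ₁ + (L : ℝ))

end CodedCaching

open CodedCaching

/-!
Achievability. Packets of each file are indexed by permutations `π` of the cache-aided users, and packet `π`
is cached at the first `t = K₁ γ₁` users in the order `π`; so each packet is in `t` caches. In one slot one can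
serve `a` cache-aided and `c` cache-less users, `a + c ≤ L + t`, because each packet sent is
unknown to at most `L - 1` of the other users served, and a channel in general position allows zero-forcing at
`L - 1` users (`exists_beam`). Symmetrization over all permutations reduces the construction of a scheme to
time sharing between pairs `(a, c)` (`linearOneShotAchievable_of_timeSharing`): part (a) uses `(t + 1, L - 1)`
and `(0, min L K₂)`, part (b) two pairs with `a + c = L + t` and consecutive `c`. Over the Gaussian
channel each slot becomes a block. A user subtracts the packets in its cache and is left with a scalar link,
over which a square constellation with an outer Gilbert-Varshamov code has a rate close to
`log₂ P` and a vanishing probability of error (`exists_blockCode`,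
`LinearOneShotAchievable.uncodedAchievable`).

Converse for linear one-shot schemes. If a slot serves `g` users, then each useful packet in it is zero-forced
at fewer than `L` of them, so it is in at least `g - L` caches. Hence packets delivered in one slot have total
weight at most `1`, when a packet in `a` caches has weight `1 / (L + a)`. Averaging over cyclic shifts of a
demand and Jensen's inequality show that no linear one-shot scheme beats `delayFew`
(`delayFew_le_of_linearOneShotAchievable`).

Information-theoretic converse. Only the marginal distributions of the noise matter, so the users may be
taken to have independent noise, and noisy observations of the signals at the `L` antennas may be added. The
typical observations over `n` channel uses then fill a volume of order `P ^ (L n)`, while the density of the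
noise is at most `1`: about `L n log₂ P` bits can be told apart (`DeliveryCode.two_pow_card_le`). The requests
of the cache-less users give `K₂ ≤ L T`. For uncoded placement, successive decoding in the order of a
permutation of the cache-aided users, averaged over permutations and demands, gives `T_{K₁} ≤ L T`,
which is needed for `L = 1`. For `L ≥ 2` the hypothesis of part (a) gives `T_{K₁} ≤ K₂`, and then
`K₂ ≤ L T` suffices.
-/

namespace CodedCaching

/-! ### Zero-forcing and the scheduling of linear one-shot slots -/

/-- In a channel in general position a packet can be zero-forced at any `L - 1` users and still be
heard by one more user. -/
theorem exists_beam {L K₁ K₂ : ℕ} {h : Channel L K₁ K₂} (hh : h ∈ genericChannels L K₁ K₂)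
    (j : User K₁ K₂) (S : Finset (User K₁ K₂)) (hj : j ∉ S) (hS : S.card + 1 ≤ L) :
    ∃ v : Fin L → ℂ, chanOut h j v ≠ 0 ∧ ∀ k ∈ S, chanOut h k v = 0 := by
  classical
  have hli := hh (insert j S) (by rw [Finset.card_insert_of_notMem hj]; exact hS)
  obtain ⟨φ, hφ⟩ : ∃ φ : (Fin L → ℂ) →ₗ[ℂ] ℂ, ∀ k : (insert j S : Finset (User K₁ K₂)),
      φ (h k) = if (k : User K₁ K₂) = j then 1 else 0 := by
    obtain ⟨φ, hφ⟩ := LinearMap.exists_extend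
      ((Module.Basis.span hli).constr ℂ (fun k : (insert j S : Finset (User K₁ K₂)) =>
        if (k : User K₁ K₂) = j then (1 : ℂ) else 0))
    refine ⟨φ, fun k => ?_⟩
    have h1 : h k = (Module.Basis.span hli k : Fin L → ℂ) := by
      rw [Module.Basis.span_apply]
    rw [h1]
    have h2 := LinearMap.congr_fun hφ (Module.Basis.span hli k)
    rw [Module.Basis.constr_basis] at h2
    exact h2
  have key : ∀ k, chanOut h k (fun a => star (φ (Pi.single a 1))) = star (φ (h k)) := by
    intro k
    have : φ (h k) = ∑ a, h k a * φ (Pi.single a 1) := by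
      conv_lhs => rw [← Finset.univ_sum_single (h k), map_sum]
      refine Finset.sum_congr rfl fun a _ => ?_
      rw [← smul_eq_mul, ← map_smul]
      congr 1
      ext b
      by_cases hb : b = a
      · subst hb; simp
      · simp [Pi.single_eq_of_ne hb]
    rw [this, star_sum, chanOut]
    exact Finset.sum_congr rfl fun a _ => by rw [star_mul']
  refine ⟨fun a => star (φ (Pi.single a 1)), ?_, fun k hk => ?_⟩
  · rw [key, hφ ⟨j, Finset.mem_insert_self _ _⟩]; simp
  · rw [key, hφ ⟨k, Finset.mem_insert_of_mem hk⟩]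
    have : k ≠ j := fun e => hj (e ▸ hk)
    simp [this]

/-- A schedule of slots is a linear one-shot scheme as soon as each packet sent in a slot has to be
zero-forced at fewer than `L` of the users served in that slot. Packets of each file are indexed by `Φ`, and
user `k` caches the packets `φ` with `cached k φ`, of every file. -/
theorem linearOneShotAchievable_of_schedule {L K₁ K₂ N : ℕ} {γ₁ T : ℝ} {Φ Sl : Type}
    [Fintype Φ] [Fintype Sl] [Nonempty Φ] (cached : User K₁ K₂ → Φ → Prop)
    [∀ k φ, Decidable (cached k φ)]
    (hcard : ∀ k, ((Finset.univ.filter (cached k)).card : ℝ) ≤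
      cacheFraction γ₁ k * Fintype.card Φ)
    (served : Sl → User K₁ K₂ → Option Φ)
    (hvalid : ∀ s k φ, served s k = some φ →
      (Finset.univ.filter fun j => j ≠ k ∧ (served s j).isSome ∧ ¬ cached j φ).card + 1 ≤ L)
    (hcomplete : ∀ k φ, ¬ cached k φ → ∃ s, served s k = some φ)
    (hT : (Fintype.card Sl : ℝ) ≤ T * Fintype.card Φ) :
    LinearOneShotAchievable γ₁ N (genericChannels L K₁ K₂) T := by
  classical
  let e := Fintype.equivFin Φ
  let es := Fintype.equivFin Sl
  refine ⟨Fintype.card Φ, Fintype.card_pos, ⟨fun k => Finset.univ.filter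
    fun p : Fin N × Fin (Fintype.card Φ) => cached k (e.symm p.2), fun k => ?_⟩, ?_⟩
  · have h1 : (Finset.univ.filter
        fun p : Fin N × Fin (Fintype.card Φ) => cached k (e.symm p.2))
        = (Finset.univ : Finset (Fin N)) ×ˢ
          ((Finset.univ.filter (cached k)).map e.toEmbedding) := by
      ext ⟨n, f⟩
      simp only [Finset.mem_filter, Finset.mem_univ, true_and, Finset.mem_product,
        Finset.mem_map, Equiv.coe_toEmbedding]
      exact ⟨fun hf => ⟨_, hf, e.apply_symm_apply f⟩, by rintro ⟨φ, hφ, rfl⟩; simpa using hφ⟩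
    rw [h1, Finset.card_product, Finset.card_map, Finset.card_univ, Fintype.card_fin]
    push_cast
    have := mul_le_mul_of_nonneg_left (hcard k) (Nat.cast_nonneg (α := ℝ) N)
    linarith
  · intro h hh d hd
    have hb : ∀ s k, ∃ v : Fin L → ℂ, ∀ φ, served s k = some φ → chanOut h k v ≠ 0 ∧
        ∀ j, j ≠ k → (served s j).isSome → ¬ cached j φ → chanOut h j v = 0 := by
      intro s k
      cases hs : served s k with
      | none => exact ⟨0, by simp⟩
      | some φ =>
        obtain ⟨v, hv, hv'⟩ := exists_beam hh k _ (by simp) (hvalid s k φ hs)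
        refine ⟨v, fun ψ hψ => ?_⟩
        obtain rfl : φ = ψ := by simpa using hψ
        exact ⟨hv, fun j h1 h2 h3 => hv' j (by simp [h1, h2, h3])⟩
    choose v hv using hb
    refine ⟨Fintype.card Sl, hT, ⟨{
      beam := fun s p => if hk : ∃ k, d k = p.1 ∧ served (es.symm s) k = some (e.symm p.2)
        then v (es.symm s) hk.choose else 0
      served := fun s k => (served (es.symm s) k).map e
      wanted_ne_zero := ?_
      interference_eq_zero := ?_
      complete := ?_ }⟩⟩
    · intro s k f hf
      obtain ⟨φ, hφ, rfl⟩ := Option.map_eq_some_iff.1 hf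
      have hk : ∃ k', d k' = d k ∧ served (es.symm s) k' = some (e.symm (e φ)) :=
        ⟨k, rfl, by simpa using hφ⟩
      simp only [dif_pos hk]
      have h2 : hk.choose = k := hd hk.choose_spec.1
      rw [h2]
      exact (hv _ _ _ hφ).1
    · intro s k f hf p hp hpc
      obtain ⟨φ, hφ, rfl⟩ := Option.map_eq_some_iff.1 hf
      by_cases hk : ∃ k', d k' = p.1 ∧ served (es.symm s) k' = some (e.symm p.2)
      · simp only [dif_pos hk]
        have hs := hk.choose_spec
        set k' := hk.choose
        refine (hv _ _ _ hs.2).2 k ?_ (by rw [hφ]; rfl) (by simpa using hpc)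
        rintro hkk
        rw [← hkk] at hs
        apply hp
        have h3 : φ = e.symm p.2 := by
          have := hφ.symm.trans hs.2
          simpa using this
        exact Prod.ext hs.1.symm (by rw [h3]; simp)
      · simp only [dif_neg hk]
        simp [chanOut]
    · intro k f hf
      obtain ⟨s, hs⟩ := hcomplete k (e.symm f) (by simpa using hf)
      exact ⟨es s, by simp [hs]⟩

/-- Splitting each packet into `I` subpackets makes a schedule that serves every uncached packet in at
least `I` slots into a scheme that serves every subpacket. -/
theorem linearOneShotAchievable_of_repeated_schedule {L K₁ K₂ N : ℕ} {γ₁ T : ℝ} {Φ Sl : Type}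
    [Fintype Φ] [Fintype Sl] [Nonempty Φ] (cached : User K₁ K₂ → Φ → Prop)
    [∀ k φ, Decidable (cached k φ)]
    (hcard : ∀ k, ((Finset.univ.filter (cached k)).card : ℝ) ≤
      cacheFraction γ₁ k * Fintype.card Φ)
    (served : Sl → User K₁ K₂ → Option Φ)
    (hvalid : ∀ s k φ, served s k = some φ →
      (Finset.univ.filter fun j => j ≠ k ∧ (served s j).isSome ∧ ¬ cached j φ).card + 1 ≤ L)
    (I : ℕ) (hI : 0 < I)
    (hcomplete : ∀ k φ, ¬ cached k φ → I ≤ Nat.card {s // served s k = some φ})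
    (hT : (Fintype.card Sl : ℝ) ≤ T * (Fintype.card Φ * I)) :
    LinearOneShotAchievable γ₁ N (genericChannels L K₁ K₂) T := by
  classical
  have hg : ∀ k φ, ∃ g : Sl → Fin I, ¬ cached k φ → ∀ i, ∃ s, served s k = some φ ∧ g s = i := by
    intro k φ
    by_cases hc : cached k φ
    · exact ⟨fun _ => ⟨0, hI⟩, fun h => absurd hc h⟩
    · have h1 := hcomplete k φ hc
      rw [Nat.card_eq_fintype_card, ← Fintype.card_fin I] at h1
      obtain ⟨f⟩ := Function.Embedding.nonempty_of_card_le h1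
      have : Nonempty (Fin I) := ⟨⟨0, hI⟩⟩
      have hf : Function.Injective fun i => (f i : Sl) :=
        Subtype.val_injective.comp f.injective
      exact ⟨Function.invFun fun i => (f i : Sl), fun _ i =>
        ⟨f i, (f i).2, Function.leftInverse_invFun hf i⟩⟩
  choose g hg using hg
  have : Nonempty (Fin I) := ⟨⟨0, hI⟩⟩
  refine linearOneShotAchievable_of_schedule (Φ := Φ × Fin I) (Sl := Sl)
    (fun k p => cached k p.1) (fun k => ?_)
    (fun s k => (served s k).map fun φ => (φ, g k φ s)) ?_ ?_ ?_
  · have h1 : (Finset.univ.filter fun p : Φ × Fin I => cached k p.1)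
        = (Finset.univ.filter (cached k)) ×ˢ Finset.univ := by
      ext ⟨φ, i⟩; simp
    rw [h1, Finset.card_product, Finset.card_univ, Fintype.card_prod]
    push_cast
    have := mul_le_mul_of_nonneg_right (hcard k) (Nat.cast_nonneg (α := ℝ) (Fintype.card (Fin I)))
    linarith
  · rintro s k ⟨φ, i⟩ hs
    obtain ⟨ψ, hψ, he⟩ := Option.map_eq_some_iff.1 hs
    obtain rfl : ψ = φ := congrArg Prod.fst he
    simpa using hvalid s k ψ hψ
  · rintro k ⟨φ, i⟩ hc
    obtain ⟨s, hs, rfl⟩ := hg k φ hc i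
    exact ⟨s, by simp [hs]⟩
  · simpa using hT

/-- A family of `c`-subsets of `Fin K` that covers each point equally often: the cyclic intervals. -/
theorem exists_balanced_family (K c : ℕ) (hc : c ≤ K) :
    ∃ C : Fin (max K 1) → Finset (Fin K), (∀ r, (C r).card ≤ c) ∧
      ∀ u, c ≤ Nat.card {r // u ∈ C r} := by
  classical
  rcases K with _ | m
  · exact ⟨fun _ => ∅, by simp, fun u => u.elim0⟩
  · have hm : max (m + 1) 1 = m + 1 := by simp
    rw [hm]
    refine ⟨fun r => Finset.univ.image fun i : Fin c => r + Fin.castLE hc i, fun r => ?_, fun u => ?_⟩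
    · exact Finset.card_image_le.trans (by simp)
    · have : Function.Injective (fun i : Fin c =>
          (⟨u - Fin.castLE hc i, Finset.mem_image.2 ⟨i, Finset.mem_univ _, sub_add_cancel _ _⟩⟩ :
            {r : Fin (m + 1) // u ∈ Finset.univ.image fun i : Fin c => r + Fin.castLE hc i})) := by
        intro i j hij
        have h1 : u - Fin.castLE hc i = u - Fin.castLE hc j := congrArg Subtype.val hij
        have h2 := sub_right_injective h1
        exact Fin.castLE_injective hc h2
      simpa only [Nat.card_eq_fintype_card, Fintype.card_fin] using Nat.card_le_card_of_injective _ this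

theorem card_perm_apply_eq (K : ℕ) (q k : Fin K) :
    (Finset.univ.filter fun π : Equiv.Perm (Fin K) => π.symm k = q).card * K = K.factorial := by
  have h1 : ∀ q', (Finset.univ.filter fun π : Equiv.Perm (Fin K) => π.symm k = q').card
      = (Finset.univ.filter fun π : Equiv.Perm (Fin K) => π.symm k = q).card := by
    intro q'
    refine Finset.card_bij (fun π _ => π * Equiv.swap q q') ?_ ?_ ?_
    · intro π hπ
      simp only [Finset.mem_filter, Finset.mem_univ, true_and] at hπ ⊢
      simp [Equiv.Perm.mul_def, hπ]
    · intro a _ b _ hab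
      exact mul_right_cancel hab
    · intro π hπ
      simp only [Finset.mem_filter, Finset.mem_univ, true_and] at hπ
      exact ⟨π * Equiv.swap q q', by simp [Equiv.Perm.mul_def, hπ], by simp [mul_assoc]⟩
  have h2 : ∑ q' : Fin K, (Finset.univ.filter fun π : Equiv.Perm (Fin K) => π.symm k = q').card
      = (Finset.univ : Finset (Equiv.Perm (Fin K))).card :=
    (Finset.card_eq_sum_card_fiberwise (f := fun π : Equiv.Perm (Fin K) => π.symm k)
      (t := Finset.univ) (fun _ _ => Finset.mem_univ _)).symm
  rw [Finset.sum_congr rfl fun q' _ => h1 q'] at h2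
  rw [Finset.sum_const, Finset.card_univ, Finset.card_univ, Fintype.card_perm, Fintype.card_fin] at h2
  rw [← h2, smul_eq_mul, mul_comm]

/-- Time sharing between slot types. A slot of type `i` serves `a i` cache-aided and `c i` cache-less
users; the time `w i / D` spent on it is measured in files. The subsets of the cache-aided users
that share a packet are symmetrized over all permutations `π` of these users: the packet `π` is cached at the
users `π 0, …, π (t - 1)`. -/
theorem linearOneShotAchievable_of_timeSharing {L K₁ K₂ N t : ℕ} {γ₁ T : ℝ}
    (htK : t < K₁) (ht : (K₁ : ℝ) * γ₁ = t) {ι : Type} [Fintype ι] (a c w : ι → ℕ) (D : ℕ)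
    (hD : 0 < D) (hc : ∀ i, c i ≤ K₂) (haK : ∀ i, a i ≤ K₁)
    (hvalid : ∀ i, a i + c i ≤ L + t) (hcL : ∀ i, c i ≤ L) (hat : ∀ i, a i = 0 ∨ t + 1 ≤ a i)
    (haided : D * (K₁ - t) ≤ ∑ i, w i * a i) (hless : D * K₂ ≤ ∑ i, w i * c i)
    (hT : ((∑ i, w i : ℕ) : ℝ) ≤ T * D) :
    LinearOneShotAchievable γ₁ N (genericChannels L K₁ K₂) T := by
  classical
  obtain ⟨M, hM⟩ : ∃ M, M = max K₂ 1 := ⟨_, rfl⟩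
  have hfam := fun i => exists_balanced_family K₂ (c i) (hc i)
  rw [← hM] at hfam
  choose C hC hC' using hfam
  let τ : Fin K₁ := ⟨t, htK⟩
  let Q := {q : Fin K₁ // t ≤ q}
  have hQ : Fintype.card Q = K₁ - t := by
    rw [Fintype.card_subtype]
    have : (Finset.univ.filter fun q : Fin K₁ => t ≤ q) = Finset.Ici τ := by
      ext q; simp [τ, Fin.le_def]
    rw [this, Fin.card_Ici]
  let ρ : Fin K₁ → Q → Equiv.Perm (Fin K₁) := fun j q => Equiv.swap j τ * Equiv.swap q.1 τ
  have hρq : ∀ j q, ρ j q q.1 = j := by intro j q; simp [ρ]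
  have hρt : ∀ (j : Fin K₁) q (p : Fin K₁), (p : ℕ) < t → ∀ i, t + 1 ≤ a i → (j : ℕ) < a i →
      ((ρ j q p : Fin K₁) : ℕ) < a i := by
    intro j q p hp i hi hj
    have hq := q.2
    have h1 : Equiv.swap q.1 τ p = p := by
      apply Equiv.swap_apply_of_ne_of_ne
      · rintro rfl; omega
      · rintro rfl; simp [τ] at hp
    simp only [ρ, Equiv.Perm.mul_apply, h1]
    by_cases hpj : p = j
    · subst hpj; simp [τ]; omega
    · rw [Equiv.swap_apply_of_ne_of_ne hpj (by rintro rfl; simp [τ] at hp)]; omega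
  let Sl := Σ i : ι, Fin (w i) × Equiv.Perm (Fin K₁) × Q × Fin M
  let cached : User K₁ K₂ → Equiv.Perm (Fin K₁) → Prop := fun k π =>
    Sum.elim (fun u => ((π.symm u : Fin K₁) : ℕ) < t) (fun _ => False) k
  let served : Sl → User K₁ K₂ → Option (Equiv.Perm (Fin K₁)) := fun s k =>
    Sum.elim (fun u => if ((s.2.2.1.symm u : Fin K₁) : ℕ) < a s.1 then
        some (s.2.2.1 * ρ (s.2.2.1.symm u) s.2.2.2.1) else none)
      (fun u => if u ∈ C s.1 s.2.2.2.2 then some s.2.2.1 else none) k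
  have hMpos : 0 < M := by simp [hM]
  have hIpos : 0 < D * (K₁ - t) * M := by
    have : 0 < K₁ - t := by omega
    positivity
  have hcardlt : (Finset.univ.filter fun q : Fin K₁ => (q : ℕ) < t).card = t := by
    have : (Finset.univ.filter fun q : Fin K₁ => (q : ℕ) < t) = Finset.Iio τ := by
      ext q; simp [τ, Fin.lt_def]
    rw [this, Fin.card_Iio]
  refine linearOneShotAchievable_of_repeated_schedule (Φ := Equiv.Perm (Fin K₁)) (Sl := Sl)
    cached ?_ served ?_ (D * (K₁ - t) * M) hIpos ?_ ?_
  · rintro (u | u)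
    · have h1 : (Finset.univ.filter (cached (Sum.inl u))).card
          = ∑ q ∈ (Finset.univ.filter fun q : Fin K₁ => (q : ℕ) < t),
            (Finset.univ.filter fun π : Equiv.Perm (Fin K₁) => π.symm u = q).card := by
        rw [Finset.card_eq_sum_card_fiberwise (f := fun π : Equiv.Perm (Fin K₁) => π.symm u)
          (t := Finset.univ.filter fun q : Fin K₁ => (q : ℕ) < t)]
        · refine Finset.sum_congr rfl fun q hq => congrArg _ ?_
          ext π
          rw [Finset.mem_filter, Finset.mem_filter, Finset.mem_filter]
          refine ⟨fun h => ⟨Finset.mem_univ _, h.2⟩, fun h => ⟨⟨Finset.mem_univ _, ?_⟩, h.2⟩⟩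
          have h3 := (Finset.mem_filter.1 hq).2
          rw [← h.2] at h3
          exact h3
        · intro π hπ
          exact Finset.mem_filter.2 ⟨Finset.mem_univ _, (Finset.mem_filter.1 hπ).2⟩
      have h2 : (Finset.univ.filter (cached (Sum.inl u))).card * K₁ = t * K₁.factorial := by
        rw [h1, Finset.sum_mul, Finset.sum_congr rfl fun q _ => card_perm_apply_eq K₁ q u,
          Finset.sum_const, hcardlt, smul_eq_mul]
      have h3 : ((Finset.univ.filter (cached (Sum.inl u))).card : ℝ) * K₁
          = t * K₁.factorial := by exact_mod_cast h2
      have hK : (0 : ℝ) < K₁ := by exact_mod_cast (by omega : 0 < K₁)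
      rw [Fintype.card_perm, Fintype.card_fin]
      simp only [cacheFraction, Sum.elim_inl]
      rw [← ht] at h3
      apply le_of_eq
      apply mul_right_cancel₀ hK.ne'
      rw [h3]; ring
    · have : Finset.univ.filter (cached (Sum.inr u)) = ∅ :=
        Finset.filter_false_of_mem fun _ _ h => h
      simp [this, cacheFraction]
  · rintro ⟨i, x, σ, q, r⟩ k φ hs
    -- the users that hear the packet as interference, split by type
    have hbound : ∀ (A : Finset (Fin K₁)) (B : Finset (Fin K₂)),
        (∀ j, Sum.inl j ≠ k → ((σ.symm j : Fin K₁) : ℕ) < a i → ¬ ((φ.symm j : Fin K₁) : ℕ) < t → j ∈ A) →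
        (∀ j, Sum.inr j ≠ k → j ∈ C i r → j ∈ B) → A.card + B.card + 1 ≤ L →
        (Finset.univ.filter fun j => j ≠ k ∧ (served ⟨i, x, σ, q, r⟩ j).isSome ∧
          ¬ cached j φ).card + 1 ≤ L := by
      intro A B hA hB hAB
      refine le_trans ?_ hAB
      have : (Finset.univ.filter fun j => j ≠ k ∧ (served ⟨i, x, σ, q, r⟩ j).isSome ∧
          ¬ cached j φ) ⊆ A.disjSum B := by
        rintro (j | j) hj
        · simp only [Finset.mem_filter, Finset.mem_univ, true_and, served, Sum.elim_inl, cached] at hj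
          rw [Finset.inl_mem_disjSum]
          refine hA j hj.1 ?_ hj.2.2
          by_contra hn
          rw [if_neg hn] at hj
          simp at hj
        · simp only [Finset.mem_filter, Finset.mem_univ, true_and, served, Sum.elim_inr, cached] at hj
          rw [Finset.inr_mem_disjSum]
          refine hB j hj.1 ?_
          by_contra hn
          rw [if_neg hn] at hj
          simp at hj
      have h2 := Finset.card_le_card this
      rw [Finset.card_disjSum] at h2
      omega
    have hcardA : ∀ (π : Equiv.Perm (Fin K₁)) (P : Finset (Fin K₁)), (P.map π.toEmbedding).card = P.card :=
      fun π P => Finset.card_map _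
    have hcardlta : (Finset.univ.filter fun p : Fin K₁ => (p : ℕ) < a i).card = a i := by
      have h0 := haK i
      rcases h0.lt_or_eq with h0 | h0
      · have : (Finset.univ.filter fun q : Fin K₁ => (q : ℕ) < a i) = Finset.Iio ⟨a i, h0⟩ := by
          ext q; simp [Fin.lt_def]
        rw [this, Fin.card_Iio]
      · rw [h0, Finset.filter_true_of_mem (fun q _ => q.2)]; simp
    have hv := hvalid i
    have hCr := hC i r
    have hcLi := hcL i
    rcases k with u | u
    · simp only [served, Sum.elim_inl] at hs
      split_ifs at hs with hu
      obtain rfl : σ * ρ (σ.symm u) q = φ := by simpa using hs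
      have hat' : t + 1 ≤ a i := (hat i).resolve_left (by omega)
      set j := σ.symm u with hj
      refine hbound ((((Finset.univ.filter fun p : Fin K₁ => (p : ℕ) < a i).erase j) \
        ((Finset.univ.filter fun p : Fin K₁ => (p : ℕ) < t).map (ρ j q).toEmbedding)).map
          σ.toEmbedding) (C i r) ?_ (fun _ _ h => h) ?_
      · intro v hv1 hv2 hv3
        rw [Finset.mem_map_equiv]
        simp only [Finset.mem_sdiff, Finset.mem_erase, Finset.mem_filter, Finset.mem_univ, true_and,
          Finset.mem_map_equiv]
        refine ⟨⟨?_, hv2⟩, hv3⟩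
        intro he
        apply hv1
        have : v = u := σ.symm.injective he
        rw [this]
      · rw [Finset.card_map, Finset.card_sdiff_of_subset, Finset.card_erase_of_mem, hcardlta, Finset.card_map,
          hcardlt]
        · omega
        · simpa using hu
        · intro p hp
          obtain ⟨p', hp', rfl⟩ := Finset.mem_map.1 hp
          simp only [Finset.mem_filter, Finset.mem_univ, true_and] at hp'
          simp only [Finset.mem_erase, Finset.mem_filter, Finset.mem_univ, true_and,
            Equiv.coe_toEmbedding]
          refine ⟨?_, hρt j q p' hp' i hat' hu⟩
          intro he
          have h5 : p' = q.1 := (ρ j q).injective (he.trans (hρq j q).symm)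
          have := q.2
          rw [h5] at hp'
          omega
    · simp only [served, Sum.elim_inr] at hs
      split_ifs at hs with hu
      obtain rfl : σ = φ := by simpa using hs
      refine hbound ((((Finset.univ.filter fun p : Fin K₁ => (p : ℕ) < a i)) \
        ((Finset.univ.filter fun p : Fin K₁ => (p : ℕ) < t))).map
          σ.toEmbedding) ((C i r).erase u) ?_ ?_ ?_
      · intro v hv1 hv2 hv3
        rw [Finset.mem_map_equiv]
        simp only [Finset.mem_sdiff, Finset.mem_filter, Finset.mem_univ, true_and]
        exact ⟨hv2, hv3⟩
      · intro v hv1 hv2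
        exact Finset.mem_erase.2 ⟨fun e => hv1 (by rw [e]), hv2⟩
      · have hCpos : 0 < (C i r).card := Finset.card_pos.2 ⟨u, hu⟩
        rw [Finset.card_map, Finset.card_erase_of_mem hu]
        rcases hat i with h0 | h0
        · have : (Finset.univ.filter fun p : Fin K₁ => (p : ℕ) < a i) = ∅ := by
            rw [h0]; simp
          rw [this]
          simp
          omega
        · rw [Finset.card_sdiff_of_subset, hcardlta, hcardlt]
          · omega
          · intro p hp
            simp only [Finset.mem_filter, Finset.mem_univ, true_and] at hp ⊢
            omega
  · rintro (u | u) π hπ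
    · simp only [cached, Sum.elim_inl, not_lt] at hπ
      let q : Q := ⟨π.symm u, hπ⟩
      let F : (Σ i : ι, Fin (w i) × Fin (a i) × Fin M) → {s : Sl // served s (Sum.inl u) = some π} :=
        fun y => ⟨⟨y.1, y.2.1, π * (ρ (Fin.castLE (haK y.1) y.2.2.1) q)⁻¹, q, y.2.2.2⟩, by
          have h1 : (π * (ρ (Fin.castLE (haK y.1) y.2.2.1) q)⁻¹).symm u
              = Fin.castLE (haK y.1) y.2.2.1 := by
            exact hρq _ q
          simp only [served, Sum.elim_inl, h1]
          rw [if_pos (by simp)]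
          simp⟩
      have hF : Function.Injective F := by
        rintro ⟨i, x, j, r⟩ ⟨i', x', j', r'⟩ he
        obtain ⟨rfl, he'⟩ := Sigma.mk.inj_iff.1 (congrArg Subtype.val he)
        have he' := eq_of_heq he'
        rw [Prod.mk.injEq, Prod.mk.injEq, Prod.mk.injEq] at he'
        obtain ⟨rfl, h2, -, rfl⟩ := he'
        have h3 := inv_injective (mul_left_cancel h2)
        have h4 : Fin.castLE (haK i) j = Fin.castLE (haK i) j' := by
          rw [← hρq (Fin.castLE (haK i) j) q, h3, hρq]
        rw [Fin.castLE_injective (haK i) h4]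
      have := Nat.card_le_card_of_injective F hF
      refine le_trans ?_ this
      rw [Nat.card_eq_fintype_card]
      simp only [Fintype.card_sigma, Fintype.card_prod, Fintype.card_fin]
      simp_rw [← mul_assoc]
      rw [← Finset.sum_mul]
      exact Nat.mul_le_mul_right _ haided
    · have hK₂ : 0 < K₂ := Fin.pos u
      have hMK : M = K₂ := by rw [hM]; exact max_eq_left hK₂
      let F : (Σ i : ι, Fin (w i) × Q × {r // u ∈ C i r}) → {s : Sl // served s (Sum.inr u) = some π} :=
        fun y => ⟨⟨y.1, y.2.1, π, y.2.2.1, y.2.2.2.1⟩, by simp [served, y.2.2.2.2]⟩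
      have hF : Function.Injective F := by
        rintro ⟨i, x, j, r⟩ ⟨i', x', j', r'⟩ he
        obtain ⟨rfl, he'⟩ := Sigma.mk.inj_iff.1 (congrArg Subtype.val he)
        have he' := eq_of_heq he'
        rw [Prod.mk.injEq, Prod.mk.injEq, Prod.mk.injEq] at he'
        obtain ⟨rfl, -, rfl, h2⟩ := he'
        obtain rfl : r = r' := Subtype.ext h2
        rfl
      have := Nat.card_le_card_of_injective F hF
      refine le_trans ?_ this
      rw [Nat.card_eq_fintype_card]
      simp only [Fintype.card_sigma, Fintype.card_prod, Fintype.card_fin, hQ]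
      calc D * (K₁ - t) * M = (K₁ - t) * (D * K₂) := by rw [hMK]; ring
        _ ≤ (K₁ - t) * ∑ i, w i * c i := Nat.mul_le_mul_left _ hless
        _ = ∑ i, w i * ((K₁ - t) * c i) := by
          rw [Finset.mul_sum]; exact Finset.sum_congr rfl fun i _ => by ring
        _ ≤ _ := by
          refine Finset.sum_le_sum fun i _ => Nat.mul_le_mul_left _ (Nat.mul_le_mul_left _ ?_)
          have := hC' i u
          rwa [Nat.card_eq_fintype_card] at this
  · have h1 : Fintype.card Sl = (∑ i, w i) * (K₁.factorial * (K₁ - t) * M) := by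
      simp only [Sl, Fintype.card_sigma, Fintype.card_prod, Fintype.card_fin, hQ, Fintype.card_perm]
      rw [Finset.sum_mul]
      exact Finset.sum_congr rfl fun i _ => by ring
    rw [h1, Fintype.card_perm, Fintype.card_fin]
    have h2 : (0 : ℝ) ≤ ((K₁.factorial * (K₁ - t) * M : ℕ) : ℝ) := Nat.cast_nonneg _
    have h3 := mul_le_mul_of_nonneg_right hT h2
    calc (((∑ i, w i) * (K₁.factorial * (K₁ - t) * M) : ℕ) : ℝ)
        = ((∑ i, w i : ℕ) : ℝ) * ((K₁.factorial * (K₁ - t) * M : ℕ) : ℝ) := by push_cast; ring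
      _ ≤ _ := h3
      _ = _ := by push_cast; ring

theorem singleStreamDelay_eq {K t : ℕ} {γ : ℝ} (ht : (K : ℝ) * γ = t) :
    singleStreamDelay K γ = ((K : ℝ) - t) / (1 + t) := by
  rw [singleStreamDelay, mul_sub, ht, mul_one]

/-- Slots for `t + 1` cache-aided and `L - 1` cache-less users until the cache-aided users are done, then
slots for cache-less users only. -/
theorem linearOneShotAchievable_delayMany {L K₁ K₂ N t : ℕ} {γ₁ : ℝ} (hL : 1 ≤ L) (htK : t < K₁)
    (ht : (K₁ : ℝ) * γ₁ = t) (h1 : ((L : ℝ) - 1) * singleStreamDelay K₁ γ₁ ≤ K₂)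
    (h2 : L ≤ K₂ + 1) :
    LinearOneShotAchievable γ₁ N (genericChannels L K₁ K₂) (delayMany L K₁ K₂ γ₁) := by
  obtain ⟨m, rfl⟩ : ∃ m, K₁ = t + m := ⟨K₁ - t, by omega⟩
  obtain ⟨l, rfl⟩ : ∃ l, L = l + 1 := ⟨L - 1, by omega⟩
  have htm : t + m - t = m := by omega
  have ht' : (0 : ℝ) < 1 + t := by positivity
  rw [delayMany]
  rw [singleStreamDelay_eq ht] at h1 ⊢
  push_cast at h1 ⊢
  simp only [add_sub_cancel_left, add_sub_cancel_right] at h1 ⊢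
  rcases Nat.eq_zero_or_pos K₂ with rfl | hK₂
  · refine linearOneShotAchievable_of_timeSharing (t := t) htK ht (ι := Unit) (fun _ => t + 1)
      (fun _ => 0) (fun _ => m) (t + 1) (by omega) (by simp) (fun _ => htK) (by intro; omega) (by simp)
      (by simp) ?_ (by simp) ?_
    · simp [htm, mul_comm]
    · have : (0 : ℝ) ≤ (l : ℝ) + 1 := by positivity
      simp only [Nat.cast_zero, min_eq_right this, div_zero, add_zero]
      push_cast
      rw [Finset.sum_const, Finset.card_univ, Fintype.card_unit, one_smul, add_comm (t : ℝ),
        div_mul_cancel₀ _ ht'.ne']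
  · have h3 : l * m ≤ (t + 1) * K₂ := by
      rw [← mul_div_assoc, div_le_iff₀ ht'] at h1
      have h4 : ((l * m : ℕ) : ℝ) ≤ (((t + 1) * K₂ : ℕ) : ℝ) := by push_cast; linarith
      exact_mod_cast h4
    obtain ⟨w, hw⟩ : ∃ w, (t + 1) * K₂ = l * m + w := ⟨_, (Nat.add_sub_cancel' h3).symm⟩
    have hw' : ((t : ℝ) + 1) * K₂ = l * m + w := by exact_mod_cast hw
    obtain ⟨u, hu⟩ : ∃ u, u = min (l + 1) K₂ := ⟨_, rfl⟩
    have hu0 : 0 < u := by rw [hu]; exact lt_min (by omega) hK₂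
    have hu' : (u : ℝ) = min ((l : ℝ) + 1) K₂ := by rw [hu]; push_cast; rfl
    have hu0' : (0 : ℝ) < u := by exact_mod_cast hu0
    have hul : u ≤ l + 1 := hu ▸ min_le_left _ _
    have huK : u ≤ K₂ := hu ▸ min_le_right _ _
    rw [← hu']
    refine linearOneShotAchievable_of_timeSharing (t := t) htK ht (ι := Fin 2) ![t + 1, 0]
      ![l, u] ![m * u, w] ((t + 1) * u) (by positivity) ?_ ?_ ?_ ?_ ?_ ?_ ?_ ?_
    · intro i; fin_cases i <;> simp <;> omega
    · intro i; fin_cases i <;> simp <;> omega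
    · intro i; fin_cases i <;> simp <;> omega
    · intro i; fin_cases i <;> simp <;> omega
    · intro i; fin_cases i <;> simp
    · rw [htm]; simp; apply le_of_eq; ring
    · simp only [Fin.sum_univ_two, Matrix.cons_val_zero, Matrix.cons_val_one]
      apply le_of_eq
      calc (t + 1) * u * K₂ = ((t + 1) * K₂) * u := by ring
        _ = _ := by rw [hw]; ring
    · simp only [Fin.sum_univ_two, Matrix.cons_val_zero, Matrix.cons_val_one]
      push_cast
      apply le_of_eq
      have h5 : (K₂ : ℝ) - l * (m / (1 + t)) = w / (1 + t) := by
        field_simp; linarith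
      rw [h5]
      field_simp
      ring

/-- Slots for `t + L` users each, of which the numbers of cache-less users, two consecutive integers, are
chosen such that both groups of users finish together. -/
theorem linearOneShotAchievable_delayFew {L K₁ K₂ N t : ℕ} {γ₁ : ℝ} (hL : 1 ≤ L) (htK : t < K₁)
    (ht : (K₁ : ℝ) * γ₁ = t) (h1 : (K₂ : ℝ) ≤ ((L : ℝ) - 1) * singleStreamDelay K₁ γ₁)
    (h2 : L + 2 * t ≤ K₁ + K₂ ∨ (K₂ = 0 ∧ L + t ≤ K₁)) :
    LinearOneShotAchievable γ₁ N (genericChannels L K₁ K₂) (delayFew L K₁ K₂ γ₁) := by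
  obtain ⟨m, rfl⟩ : ∃ m, K₁ = t + m := ⟨K₁ - t, by omega⟩
  obtain ⟨l, rfl⟩ : ∃ l, L = l + 1 := ⟨L - 1, by omega⟩
  have htm : t + m - t = m := by omega
  have hm : 0 < m := by omega
  have ht' : (0 : ℝ) < 1 + t := by positivity
  rw [delayFew, mul_sub, ht]
  rw [singleStreamDelay_eq ht] at h1
  push_cast at h1 ⊢
  simp only [add_sub_cancel_left, add_sub_cancel_right, mul_one] at h1 ⊢
  have h3 : (t + 1) * K₂ ≤ l * m := by
    rw [← mul_div_assoc, le_div_iff₀ ht'] at h1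
    have h4 : (((t + 1) * K₂ : ℕ) : ℝ) ≤ ((l * m : ℕ) : ℝ) := by push_cast; linarith
    exact_mod_cast h4
  -- the time share `w / (m + K₂)` goes to slots with the larger number of cache-less users
  obtain ⟨c, w, hcw, hwlt⟩ : ∃ c w, (m + K₂) * c + w = (t + l + 1) * K₂ ∧ w < m + K₂ :=
    ⟨_, _, Nat.div_add_mod ((t + l + 1) * K₂) (m + K₂), Nat.mod_lt _ (by omega)⟩
  obtain ⟨w', hw'⟩ : ∃ w', w + w' = m + K₂ := ⟨_, Nat.add_sub_cancel' hwlt.le⟩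
  obtain ⟨e, he, he1, he0⟩ : ∃ e, w * e = w ∧ e ≤ 1 ∧ (0 < e → 0 < w) := by
    rcases Nat.eq_zero_or_pos w with h | h
    · exact ⟨0, by simp [h], by simp, by simp⟩
    · exact ⟨1, by simp, le_rfl, fun _ => h⟩
  have hupper : ∀ b, (t + l + 1) * K₂ ≤ (m + K₂) * b → c + e ≤ b := by
    intro b hb
    have hcb : (m + K₂) * c + w ≤ (m + K₂) * b := hcw ▸ hb
    rcases Nat.eq_zero_or_pos e with h | h
    · rw [h, add_zero]
      exact Nat.le_of_mul_le_mul_left (le_trans (Nat.le_add_right _ _) hcb) (by omega)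
    · have : c < b := Nat.lt_of_mul_lt_mul_left (a := m + K₂) (by have := he0 h; omega)
      omega
  have hcl : c + e ≤ l := hupper l (by nlinarith)
  have hcK : c + e ≤ K₂ := hupper K₂ (by
    rcases h2 with h2 | ⟨h2, -⟩
    · rw [mul_comm]; nlinarith
    · simp [h2])
  have hlow : t + l + 1 ≤ t + m + c := by
    by_contra hn
    have h5 : (m + K₂) * (t + m + c + 1) ≤ (m + K₂) * (t + l + 1) := Nat.mul_le_mul_left _ (by omega)
    have h6 : (t + l + 1) * m ≤ (m + K₂) * (t + m) := by
      rcases h2 with h2 | ⟨h2, h2'⟩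
      · nlinarith
      · subst h2; nlinarith
    nlinarith
  have hsum : w' * c + w * (c + e) = (t + l + 1) * K₂ := by
    rw [← hcw, ← hw', mul_add, he]; ring
  obtain ⟨a, ha⟩ : ∃ a, a + (c + e) = t + l + 1 := ⟨_, Nat.sub_add_cancel (by omega)⟩
  refine linearOneShotAchievable_of_timeSharing (t := t) htK ht (ι := Fin 2)
      ![a + e, a] ![c, c + e] ![w', w] (t + l + 1) (by positivity) ?_ ?_ ?_ ?_ ?_ ?_ ?_ ?_
  · intro i; fin_cases i <;> simp <;> omega
  · intro i; fin_cases i <;> simp <;> omega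
  · intro i; fin_cases i <;> simp <;> omega
  · intro i; fin_cases i <;> simp <;> omega
  · intro i; fin_cases i <;> simp <;> omega
  · simp only [htm, Fin.sum_univ_two, Matrix.cons_val_zero, Matrix.cons_val_one]
    have : w' * (a + e) + w * a + (w' * c + w * (c + e)) = (m + K₂) * (t + l + 1) := by
      calc _ = (w' + w) * (a + (c + e)) := by ring
        _ = _ := by rw [ha, add_comm w', hw']
    rw [hsum] at this
    nlinarith
  · simp only [Fin.sum_univ_two, Matrix.cons_val_zero, Matrix.cons_val_one]
    exact hsum.ge
  · simp only [Fin.sum_univ_two, Matrix.cons_val_zero, Matrix.cons_val_one]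
    rw [add_comm w', hw']
    push_cast
    apply le_of_eq
    have : (t : ℝ) + (l + 1) ≠ 0 := by positivity
    field_simp
    ring

/-! ### Bounds that hold on average over the demands -/

/-- Cyclic shifts of one demand: all requests are different in each, and each user requests each file
once. -/
theorem exists_balanced_demands {K₁ K₂ N : ℕ} (hN : K₁ + K₂ ≤ N) (hN0 : 0 < N) :
    ∃ dd : Fin N → User K₁ K₂ → Fin N, (∀ c, Function.Injective (dd c)) ∧
      ∀ k, Function.Bijective fun c => dd c k := by
  have : NeZero N := ⟨hN0.ne'⟩
  refine ⟨fun c k => Fin.castLE hN (finSumFinEquiv k) + c, fun c k k' h => ?_, fun k => ?_⟩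
  · exact finSumFinEquiv.injective (Fin.castLE_injective hN (add_right_cancel h))
  · exact (Equiv.addLeft (Fin.castLE hN (finSumFinEquiv k) : Fin N)).bijective

/-- Jensen's inequality for the convex function `x ↦ (K - x) / (l + x)`, which is decreasing. -/
theorem card_mul_div_le_sum {ι : Type*} [Fintype ι] (a : ι → ℝ) (ha : ∀ p, 0 ≤ a p) {K l t : ℝ}
    (hK : 0 ≤ K) (hl : 0 < l) (ht : 0 ≤ t) (hsum : ∑ p, a p ≤ t * Fintype.card ι) :
    Fintype.card ι * ((K - t) / (l + t)) ≤ ∑ p, (K - a p) / (l + a p) := by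
  have hlt : 0 < l + t := by linarith
  have h1 : ∀ p, (K - t) / (l + t) - (K + l) / (l + t) ^ 2 * (a p - t) ≤ (K - a p) / (l + a p) := by
    intro p
    have hla : 0 < l + a p := by linarith [ha p]
    have : (K - a p) / (l + a p) - ((K - t) / (l + t) - (K + l) / (l + t) ^ 2 * (a p - t))
        = (K + l) * (a p - t) ^ 2 / ((l + t) ^ 2 * (l + a p)) := by
      field_simp; ring
    have h2 : 0 ≤ (K + l) * (a p - t) ^ 2 / ((l + t) ^ 2 * (l + a p)) := by positivity
    linarith
  have h2 := Finset.sum_le_sum fun p (_ : p ∈ Finset.univ) => h1 p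
  rw [Finset.sum_sub_distrib, ← Finset.mul_sum, Finset.sum_sub_distrib] at h2
  simp only [Finset.sum_const, Finset.card_univ, nsmul_eq_mul] at h2
  have h3 : 0 ≤ (K + l) / (l + t) ^ 2 := by positivity
  nlinarith

/-! ### The converse for linear one-shot schemes -/

theorem chanOut_eq_zero_imp {L K₁ K₂ : ℕ} {h : Channel L K₁ K₂} (hh : h ∈ genericChannels L K₁ K₂)
    (S : Finset (User K₁ K₂)) (hS : L ≤ S.card) (v : Fin L → ℂ)
    (hv : ∀ k ∈ S, chanOut h k v = 0) : v = 0 := by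
  obtain ⟨S', hS', hcard⟩ := Finset.exists_subset_card_eq hS
  have hli := hh S' hcard.le
  have hspan : Submodule.span ℂ (Set.range fun k : S' => h k) = ⊤ := by
    apply hli.span_eq_top_of_card_eq_finrank'
    simp [hcard]
  have key : ∀ x ∈ Submodule.span ℂ (Set.range fun k : S' => h k), ∑ a, x a * star (v a) = 0 := by
    intro x hx
    induction hx using Submodule.span_induction with
    | mem x hx =>
      obtain ⟨k, rfl⟩ := hx
      have h1 := congrArg star (hv k (hS' k.2))
      rw [chanOut, star_sum, star_zero] at h1
      rw [← h1]
      exact Finset.sum_congr rfl fun a _ => by rw [star_mul', star_star]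
    | zero => simp
    | add x y _ _ hx hy => simp only [Pi.add_apply, add_mul, Finset.sum_add_distrib, hx, hy, add_zero]
    | smul c x _ hx => simp only [Pi.smul_apply, smul_eq_mul, mul_assoc, ← Finset.mul_sum, hx, mul_zero]
  ext a
  have := key (Pi.single a 1) (hspan ▸ Submodule.mem_top)
  simpa [Pi.single_apply] using this

/-- A useful packet sent in a slot that serves `g` users is zero-forced at fewer than `L` users, so at
least `g - L` users have it in their caches. Counted with weight `1 / (L + number of caches)`,
each slot thus delivers packets of total weight at most `1`. -/
theorem LinearDelivery.slot_weight_le {L K₁ K₂ N F : ℕ} {γ₁ : ℝ} {Z : PacketPlacement K₁ K₂ γ₁ N F}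
    {h : Channel L K₁ K₂} (hh : h ∈ genericChannels L K₁ K₂) (hL : 1 ≤ L) {d : User K₁ K₂ → Fin N}
    (hd : Function.Injective d) {H : ℕ} (D : LinearDelivery Z h d H) (s : Fin H) :
    ∑ k, ∑ f, (if D.served s k = some f ∧ (d k, f) ∉ Z.cache k then
      (1 : ℝ) / (L + (Finset.univ.filter fun j => (d k, f) ∈ Z.cache j).card) else 0) ≤ 1 := by
  classical
  set G := Finset.univ.filter fun k => ∃ f, D.served s k = some f ∧ (d k, f) ∉ Z.cache k with hG
  have hbound : ∀ k f, D.served s k = some f → (d k, f) ∉ Z.cache k →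
      G.card ≤ L + (Finset.univ.filter fun j => (d k, f) ∈ Z.cache j).card := by
    intro k f hs hc
    set A := Finset.univ.filter fun j => (d k, f) ∈ Z.cache j with hA
    have hkG : k ∈ G := by simp only [hG, Finset.mem_filter, Finset.mem_univ, true_and]; exact ⟨f, hs, hc⟩
    have h1 : ((G \ A).erase k).card < L := by
      by_contra hn
      push Not at hn
      apply D.wanted_ne_zero s k f hs
      rw [chanOut_eq_zero_imp hh _ hn (D.beam s (d k, f))]
      · simp [chanOut]
      · intro j hj
        simp only [Finset.mem_erase, Finset.mem_sdiff, hG, hA, Finset.mem_filter, Finset.mem_univ,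
          true_and] at hj
        obtain ⟨hjk, ⟨g, hg, -⟩, hj2⟩ := hj
        exact D.interference_eq_zero s j g hg _ (fun e => hjk (hd (congrArg Prod.fst e).symm)) hj2
    have h2 : G.card ≤ (G \ A).card + A.card := by
      have := Finset.card_le_card_sdiff_add_card (s := G) (t := A)
      exact this
    have h3 := Finset.pred_card_le_card_erase (s := G \ A) (a := k)
    omega
  have hinner : ∀ k, ∑ f, (if D.served s k = some f ∧ (d k, f) ∉ Z.cache k then
      (1 : ℝ) / (L + (Finset.univ.filter fun j => (d k, f) ∈ Z.cache j).card) else 0)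
      ≤ if k ∈ G then 1 / (G.card : ℝ) else 0 := by
    intro k
    by_cases hk : k ∈ G
    · rw [if_pos hk]
      obtain ⟨f, hf, hfc⟩ := (Finset.mem_filter.1 hk).2
      rw [Finset.sum_eq_single f]
      · rw [if_pos ⟨hf, hfc⟩]
        apply one_div_le_one_div_of_le
        · exact_mod_cast Finset.card_pos.2 ⟨k, hk⟩
        · exact_mod_cast hbound k f hf hfc
      · intro g _ hg
        rw [if_neg]
        rintro ⟨h1, -⟩
        exact hg (by rw [hf] at h1; exact (Option.some.inj h1).symm)
      · simp
    · rw [if_neg hk]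
      refine (Finset.sum_eq_zero fun f _ => if_neg ?_).le
      intro hf
      exact hk (Finset.mem_filter.2 ⟨Finset.mem_univ _, f, hf⟩)
  refine (Finset.sum_le_sum fun k _ => hinner k).trans ?_
  rw [← Finset.sum_filter, Finset.sum_const, nsmul_eq_mul]
  simp only [Finset.filter_mem_eq_inter, Finset.univ_inter]
  rw [mul_one_div]
  exact div_self_le_one _

theorem sum_cacheFraction {K₁ K₂ : ℕ} (γ₁ : ℝ) :
    ∑ k : User K₁ K₂, cacheFraction γ₁ k = K₁ * γ₁ := by
  simp [cacheFraction, Fintype.sum_sum_type]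

theorem delayFew_le_of_linearOneShotAchievable {L K₁ K₂ N t : ℕ} {γ₁ T : ℝ} (hL : 1 ≤ L)
    (hK₁ : 1 ≤ K₁) (ht : (K₁ : ℝ) * γ₁ = t) (hN : K₁ + K₂ ≤ N) {h : Channel L K₁ K₂}
    (hh : h ∈ genericChannels L K₁ K₂) (hT : LinearOneShotAchievable γ₁ N {h} T) :
    delayFew L K₁ K₂ γ₁ ≤ T := by
  classical
  obtain ⟨F, hF, Z, hZ⟩ := hT
  obtain ⟨dd, hdd, hdd'⟩ := exists_balanced_demands hN (by omega)
  let A : Fin N × Fin F → ℝ := fun p => ((Finset.univ.filter fun j => p ∈ Z.cache j).card : ℝ)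
  let φ : User K₁ K₂ → Fin N × Fin F → ℝ := fun k p => if p ∉ Z.cache k then 1 / (L + A p) else 0
  have hA : ∀ p, 0 ≤ A p := fun p => Nat.cast_nonneg _
  have hLpos : (0 : ℝ) < L := by exact_mod_cast hL
  have h1 : ∀ c, ∑ k, ∑ f, φ k (dd c k, f) ≤ T * F := by
    intro c
    obtain ⟨H, hH, ⟨D⟩⟩ := hZ h rfl (dd c) (hdd c)
    refine le_trans ?_ hH
    have h2 := Finset.sum_le_sum fun s (_ : s ∈ Finset.univ) => D.slot_weight_le hh hL (hdd c) s
    rw [Finset.sum_const, Finset.card_univ, Fintype.card_fin, nsmul_eq_mul, mul_one] at h2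
    rw [Finset.sum_comm] at h2
    refine le_trans ?_ h2
    refine Finset.sum_le_sum fun k _ => ?_
    rw [Finset.sum_comm]
    refine Finset.sum_le_sum fun f _ => ?_
    have hnn : ∀ s, (0 : ℝ) ≤ if D.served s k = some f ∧ (dd c k, f) ∉ Z.cache k then
      (1 : ℝ) / (L + (Finset.univ.filter fun j => (dd c k, f) ∈ Z.cache j).card) else 0 := by
      intro s; split_ifs <;> positivity
    by_cases hc : (dd c k, f) ∈ Z.cache k
    · have h0 : φ k (dd c k, f) = 0 := by simp [φ, hc]
      rw [h0]
      exact Finset.sum_nonneg fun s _ => hnn s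
    · obtain ⟨s, hs⟩ := D.complete k f hc
      refine le_trans ?_ (Finset.single_le_sum (fun s _ => hnn s) (Finset.mem_univ s))
      simp [φ, hc, hs, A]
  have h2 : ∑ c, ∑ k, ∑ f, φ k (dd c k, f) = ∑ p, ((K₁ + K₂ : ℝ) - A p) / (L + A p) := by
    rw [Finset.sum_comm]
    have h3 : ∀ k, ∑ c, ∑ f, φ k (dd c k, f) = ∑ p, φ k p := by
      intro k
      rw [Fintype.sum_prod_type]
      exact (hdd' k).sum_comp (fun n => ∑ f, φ k (n, f))
    rw [Finset.sum_congr rfl fun k _ => h3 k, Finset.sum_comm]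
    refine Finset.sum_congr rfl fun p _ => ?_
    simp only [φ]
    rw [← Finset.sum_filter, Finset.sum_const, nsmul_eq_mul, mul_one_div]
    congr 1
    have := Finset.card_filter_add_card_filter_not (s := (Finset.univ : Finset (User K₁ K₂)))
      (fun k => p ∈ Z.cache k)
    have h4 : (Finset.univ : Finset (User K₁ K₂)).card = K₁ + K₂ := by simp
    rw [h4] at this
    have h5 : A p + ((Finset.univ.filter fun k => p ∉ Z.cache k).card : ℝ) = K₁ + K₂ := by
      simp only [A]
      exact_mod_cast this
    linarith
  have h3 : ∑ p, A p ≤ t * Fintype.card (Fin N × Fin F) := by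
    have : ∑ p, A p = ∑ k, ((Z.cache k).card : ℝ) := by
      simp only [A]
      rw [← Nat.cast_sum, ← Nat.cast_sum]
      congr 1
      simp_rw [Finset.card_filter]
      rw [Finset.sum_comm]
      refine Finset.sum_congr rfl fun k _ => ?_
      rw [← Finset.card_filter]; simp
    rw [this]
    refine (Finset.sum_le_sum fun k _ => Z.card_le k).trans ?_
    rw [← Finset.sum_mul, ← Finset.sum_mul, sum_cacheFraction, ht]
    simp [mul_assoc]
  have h4 := card_mul_div_le_sum A hA (K := K₁ + K₂) (l := L) (t := t) (by positivity) hLpos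
    (by positivity) h3
  rw [← h2] at h4
  have h5 := h4.trans (Finset.sum_le_sum fun c _ => h1 c)
  rw [Finset.sum_const, Finset.card_univ, Fintype.card_fin, nsmul_eq_mul, Fintype.card_prod,
    Fintype.card_fin, Fintype.card_fin] at h5
  push_cast at h5
  have hNpos : (0 : ℝ) < N * F := by
    have : 0 < N := by omega
    positivity
  have h6 : ((K₁ : ℝ) + K₂ - t) / (L + t) ≤ T := by
    refine le_of_mul_le_mul_left ?_ hNpos
    linarith
  rw [delayFew, mul_sub, ht]
  refine le_trans (le_of_eq ?_) h6
  congr 1 <;> ring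

/-! ### Gaussian noise -/

instance : IsProbabilityMeasure complexGaussian := by
  rw [complexGaussian]
  refine Measure.isProbabilityMeasure_map ?_
  exact (Complex.measurableEquivRealProd.symm.measurable).aemeasurable

instance (n : ℕ) : IsProbabilityMeasure (noise n) := by
  rw [noise]; infer_instance

/-- Marginals of an i.i.d. family are i.i.d. -/
theorem map_pi_comp_injective {ι ι' α : Type*} [Fintype ι] [Fintype ι'] [MeasurableSpace α]
    (μ : Measure α) [IsProbabilityMeasure μ] (f : ι' → ι) (hf : Function.Injective f) :
    (Measure.pi fun _ : ι => μ).map (fun w i => w (f i)) = Measure.pi fun _ : ι' => μ := by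
  classical
  symm
  apply Measure.pi_eq
  intro s hs
  rw [Measure.map_apply (by fun_prop) (MeasurableSet.univ_pi hs)]
  have h1 : (fun (w : ι → α) i => w (f i)) ⁻¹' Set.univ.pi s
      = Set.univ.pi fun j => if hj : ∃ i, f i = j then s hj.choose else Set.univ := by
    ext w
    simp only [Set.mem_preimage, Set.mem_pi, Set.mem_univ, true_implies]
    constructor
    · intro h j
      by_cases hj : ∃ i, f i = j
      · rw [dif_pos hj]
        have := h hj.choose
        rwa [hj.choose_spec] at this
      · rw [dif_neg hj]; trivial
    · intro h i
      have h2 := h (f i)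
      have hj : ∃ i', f i' = f i := ⟨i, rfl⟩
      rw [dif_pos hj] at h2
      rwa [hf hj.choose_spec] at h2
  rw [h1, Measure.pi_pi]
  rw [← Finset.prod_subset (Finset.subset_univ (Finset.univ.image f))]
  · rw [Finset.prod_image fun a _ b _ h => hf h]
    refine Finset.prod_congr rfl fun i _ => ?_
    have hj : ∃ i', f i' = f i := ⟨i, rfl⟩
    rw [dif_pos hj, hf hj.choose_spec]
  · intro j _ hj
    rw [dif_neg, measure_univ]
    rintro ⟨i, rfl⟩
    exact hj (Finset.mem_image_of_mem _ (Finset.mem_univ _))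

theorem pi_le_pi {ι α : Type*} [Fintype ι] [MeasurableSpace α] {μ ν : Measure α} [SigmaFinite μ]
    [SigmaFinite ν] (h : μ ≤ ν) : (Measure.pi fun _ : ι => μ) ≤ Measure.pi fun _ : ι => ν := by
  have h1 : (Measure.pi fun _ : ι => μ).toOuterMeasure
      ≤ OuterMeasure.pi fun _ : ι => ν.toOuterMeasure := by
    rw [OuterMeasure.le_pi]
    intro s _
    have := Measure.pi_pi (fun _ : ι => μ) s
    calc _ = ∏ i, μ (s i) := this
      _ ≤ _ := Finset.prod_le_prod' fun i _ => h (s i)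
  rw [Measure.le_iff]
  intro s hs
  have h2 := h1 s
  refine h2.trans (le_of_eq ?_)
  rw [Measure.pi, toMeasure_apply _ _ hs]

theorem gaussianReal_le_volume : gaussianReal 0 (1 / 2) ≤ volume := by
  rw [gaussianReal_of_var_ne_zero _ (by norm_num)]
  calc volume.withDensity (gaussianPDF 0 (1 / 2)) ≤ volume.withDensity 1 := by
        refine withDensity_mono (ae_of_all _ fun x => ?_)
        rw [gaussianPDF, Pi.one_apply]
        rw [← ENNReal.ofReal_one]
        apply ENNReal.ofReal_le_ofReal
        rw [gaussianPDFReal]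
        have h1 : Real.exp (-(x - 0) ^ 2 / (2 * ((1 / 2 : NNReal) : ℝ))) ≤ 1 := by
          rw [Real.exp_le_one_iff]
          apply div_nonpos_of_nonpos_of_nonneg
          · simpa using sq_nonneg x
          · positivity
        have h2 : (√(2 * Real.pi * ((1 / 2 : NNReal) : ℝ)))⁻¹ ≤ 1 := by
          apply inv_le_one_of_one_le₀
          rw [Real.one_le_sqrt]
          have := Real.pi_gt_three
          push_cast
          linarith
        exact mul_le_one₀ h2 (Real.exp_pos _).le h1
    _ = volume := withDensity_one

/-- The density of the noise is at most `1`. -/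
theorem complexGaussian_le_volume : complexGaussian ≤ volume := by
  have h1 : (fun p : ℝ × ℝ => (⟨p.1, p.2⟩ : ℂ)) = Complex.measurableEquivRealProd.symm := by
    ext p; rfl
  rw [complexGaussian, h1, ← Complex.volume_preserving_equiv_real_prod.symm.map_eq]
  refine Measure.map_mono ?_ Complex.measurableEquivRealProd.symm.measurable
  exact Measure.prod_mono gaussianReal_le_volume gaussianReal_le_volume

theorem lintegral_sq_gaussianReal :
    ∫⁻ x, ENNReal.ofReal (x ^ 2) ∂(gaussianReal 0 (1 / 2)) = ENNReal.ofReal (1 / 2) := by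
  have hm : MemLp id 2 (gaussianReal 0 (1 / 2)) := memLp_id_gaussianReal 2
  have h1 := variance_eq_sub hm
  rw [variance_id_gaussianReal] at h1
  have h2 : ∫ x, x ^ 2 ∂(gaussianReal 0 (1 / 2)) = 1 / 2 := by
    simp only [id_eq, integral_id_gaussianReal] at h1
    simpa using h1.symm
  rw [← h2]
  exact (ofReal_integral_eq_lintegral_ofReal hm.integrable_sq
    (ae_of_all _ fun x => sq_nonneg x)).symm

theorem lintegral_norm_sq_complexGaussian :
    ∫⁻ z, ENNReal.ofReal (‖z‖ ^ 2) ∂complexGaussian = 1 := by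
  have hmeas : Measurable fun p : ℝ × ℝ => (⟨p.1, p.2⟩ : ℂ) :=
    Complex.measurableEquivRealProd.symm.measurable
  rw [complexGaussian, lintegral_map (by fun_prop) hmeas]
  have h1 : ∀ p : ℝ × ℝ, ENNReal.ofReal (‖(⟨p.1, p.2⟩ : ℂ)‖ ^ 2)
      = ENNReal.ofReal (p.1 ^ 2) + ENNReal.ofReal (p.2 ^ 2) := by
    intro p
    rw [← ENNReal.ofReal_add (sq_nonneg _) (sq_nonneg _), Complex.sq_norm, Complex.normSq_mk]
    ring_nf
  simp_rw [h1]
  rw [lintegral_add_left (by fun_prop)]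
  rw [lintegral_prod _ (by fun_prop), lintegral_prod _ (by fun_prop)]
  simp only [lintegral_const, measure_univ, mul_one, lintegral_sq_gaussianReal]
  rw [← ENNReal.ofReal_add (by norm_num) (by norm_num)]
  norm_num

/-- Markov's inequality for the energy of i.i.d. noise. -/
theorem pi_complexGaussian_energy_le {ι : Type*} [Fintype ι] {c : ℝ} (hc : 0 < c) :
    (Measure.pi fun _ : ι => complexGaussian).real
      {w | c * Fintype.card ι < ∑ i, ‖w i‖ ^ 2} ≤ 1 / c := by
  rcases isEmpty_or_nonempty ι with hι | hι
  · simp [hc.le]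
  have h1 : ∫⁻ w, ENNReal.ofReal (∑ i, ‖w i‖ ^ 2) ∂(Measure.pi fun _ : ι => complexGaussian)
      = Fintype.card ι := by
    simp_rw [ENNReal.ofReal_sum_of_nonneg fun i (_ : i ∈ Finset.univ) => sq_nonneg ‖_‖]
    rw [lintegral_finsetSum _ (by fun_prop)]
    have : ∀ i : ι, ∫⁻ w, ENNReal.ofReal (‖w i‖ ^ 2) ∂(Measure.pi fun _ : ι => complexGaussian)
        = 1 := by
      intro i
      rw [← lintegral_norm_sq_complexGaussian]
      exact (measurePreserving_eval (fun _ : ι => complexGaussian) i).lintegral_comp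
        (f := fun z => ENNReal.ofReal (‖z‖ ^ 2)) (by fun_prop)
    rw [Finset.sum_congr rfl fun i _ => this i]
    simp
  have hpos : (0 : ℝ) < Fintype.card ι := by exact_mod_cast Fintype.card_pos
  have h2 := mul_meas_ge_le_lintegral (μ := Measure.pi fun _ : ι => complexGaussian)
    (f := fun w : ι → ℂ => ENNReal.ofReal (∑ i, ‖w i‖ ^ 2)) (by fun_prop)
    (ENNReal.ofReal (c * Fintype.card ι))
  rw [h1] at h2
  set S : Set (ι → ℂ) := {w | c * Fintype.card ι < ∑ i, ‖w i‖ ^ 2} with hS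
  have h3 : ENNReal.ofReal (c * Fintype.card ι) * (Measure.pi fun _ : ι => complexGaussian) S
      ≤ Fintype.card ι := by
    refine le_trans ?_ h2
    gcongr
    intro w hw
    exact ENNReal.ofReal_le_ofReal (le_of_lt hw)
  have h4 := ENNReal.toReal_mono (by simp) h3
  rw [ENNReal.toReal_mul, ENNReal.toReal_ofReal (by positivity), ENNReal.toReal_natCast] at h4
  rw [Measure.real, le_div_iff₀ hc]
  refine le_of_mul_le_mul_left ?_ hpos
  linarith

theorem exists_complexGaussian_tail_le {ε : ℝ} (hε : 0 < ε) :
    ∃ r : ℝ, 0 < r ∧ complexGaussian.real {z | r ≤ ‖z‖} ≤ ε := by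
  refine ⟨√(1 / ε) + 1, by positivity, ?_⟩
  have h1 := mul_meas_ge_le_lintegral (μ := complexGaussian)
    (f := fun z => ENNReal.ofReal (‖z‖ ^ 2)) (by fun_prop) (ENNReal.ofReal (1 / ε))
  rw [lintegral_norm_sq_complexGaussian] at h1
  have h3 : ENNReal.ofReal (1 / ε) * complexGaussian {z | √(1 / ε) + 1 ≤ ‖z‖} ≤ 1 := by
    refine le_trans ?_ h1
    gcongr with z
    intro hz
    apply ENNReal.ofReal_le_ofReal
    have h0 := Real.sqrt_nonneg (1 / ε)
    have hz' : √(1 / ε) ≤ ‖z‖ := by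
      have : √(1 / ε) + 1 ≤ ‖z‖ := hz
      linarith
    rw [← Real.sqrt_le_left (norm_nonneg z)]
    exact hz'
  have h4 := ENNReal.toReal_mono (by simp) h3
  rw [ENNReal.toReal_mul, ENNReal.toReal_ofReal (by positivity), ENNReal.toReal_one] at h4
  rw [Measure.real]
  rwa [one_div_mul_eq_div, div_le_one hε] at h4

/-- Stirling's bound for the volume of a ball in `ℂ^ι`, of which the squared radius is proportional to the
dimension. -/
theorem volume_ball_le {ι : Type*} [Fintype ι] {ρ : ℝ} (hρ : 0 ≤ ρ) :
    volume {x : ι → ℂ | ∑ i, ‖x i‖ ^ 2 ≤ Fintype.card ι * ρ}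
      ≤ ENNReal.ofReal ((Real.pi * Real.exp 1 * ρ) ^ Fintype.card ι) := by
  rcases isEmpty_or_nonempty ι with hι | hι
  · rw [Fintype.card_eq_zero, pow_zero, ENNReal.ofReal_one]
    refine (measure_mono (Set.subset_univ _)).trans ?_
    rw [volume_pi, Measure.pi_univ]; simp
  set m := Fintype.card ι with hm
  have hmpos : 0 < m := Fintype.card_pos
  have h1 := Complex.volume_sum_rpow_le ι (p := 2) (by norm_num) (√(m * ρ))
  have h2 : {x : ι → ℂ | ∑ i, ‖x i‖ ^ 2 ≤ m * ρ}
      = {x : ι → ℂ | (∑ i, ‖x i‖ ^ (2 : ℝ)) ^ ((1 : ℝ) / 2) ≤ √(m * ρ)} := by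
    ext x
    simp only [Set.mem_ofPred_eq, Real.rpow_two]
    rw [← Real.sqrt_eq_rpow, Real.sqrt_le_sqrt_iff (by positivity)]
  rw [h2, h1, ← ENNReal.ofReal_pow (Real.sqrt_nonneg _), ← ENNReal.ofReal_mul (by positivity)]
  apply ENNReal.ofReal_le_ofReal
  rw [pow_mul, Real.sq_sqrt (by positivity)]
  have h3 : (2 : ℝ) / 2 + 1 = 2 := by norm_num
  have h4 : (2 : ℝ) * (m : ℝ) / 2 + 1 = m + 1 := by ring
  rw [h3, ← hm, h4, Real.Gamma_two, mul_one, Real.Gamma_nat_eq_factorial]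
  have h5 := Real.pow_div_factorial_le_exp (m : ℝ) (by positivity) m
  have h6 : (0 : ℝ) ≤ ρ ^ m * Real.pi ^ m := by positivity
  calc ((m : ℝ) * ρ) ^ m * (Real.pi ^ m / (m.factorial : ℝ))
      = (ρ ^ m * Real.pi ^ m) * ((m : ℝ) ^ m / (m.factorial : ℝ)) := by rw [mul_pow]; ring
    _ ≤ (ρ ^ m * Real.pi ^ m) * Real.exp m := mul_le_mul_of_nonneg_left h5 h6
    _ = _ := by
      rw [mul_pow, mul_pow, ← Real.exp_nat_mul, mul_one]; ring

/-! ### Point-to-point codes: amplitude modulation with an outer Gilbert-Varshamov code -/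

theorem card_hammingBall_le {ι A : Type*} [Fintype ι] [DecidableEq ι] [Fintype A] [DecidableEq A]
    (hA : 0 < Fintype.card A) (x : ι → A) (r : ℕ) :
    (Finset.univ.filter fun y => hammingDist x y ≤ r).card
      ≤ 2 ^ Fintype.card ι * Fintype.card A ^ r := by
  have hsub : (Finset.univ.filter fun y => hammingDist x y ≤ r) ⊆
      (Finset.univ.filter fun D : Finset ι => D.card ≤ r).biUnion fun D =>
        Fintype.piFinset fun i => if i ∈ D then Finset.univ else {x i} := by
    intro y hy
    rw [Finset.mem_biUnion]
    refine ⟨Finset.univ.filter fun i => x i ≠ y i, ?_, ?_⟩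
    · simpa [hammingDist] using hy
    · rw [Fintype.mem_piFinset]
      intro i
      by_cases h : x i = y i <;> simp [h]
  refine (Finset.card_le_card hsub).trans (Finset.card_biUnion_le.trans ?_)
  calc _ ≤ ∑ D ∈ (Finset.univ.filter fun D : Finset ι => D.card ≤ r), Fintype.card A ^ r := by
        refine Finset.sum_le_sum fun D hD => ?_
        rw [Fintype.card_piFinset]
        have h1 : ∀ i, (if i ∈ D then (Finset.univ : Finset A) else {x i}).card
            = if i ∈ D then Fintype.card A else 1 := by
          intro i; split_ifs <;> simp
        simp_rw [h1]
        rw [Finset.prod_ite_mem, Finset.univ_inter, Finset.prod_const]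
        exact Nat.pow_le_pow_right hA (Finset.mem_filter.1 hD).2
    _ ≤ _ := by
        rw [Finset.sum_const, smul_eq_mul]
        refine Nat.mul_le_mul_right _ ?_
        refine (Finset.card_filter_le _ _).trans ?_
        simp

/-- The Gilbert-Varshamov bound, by greedy choice of the codewords. -/
theorem exists_code_of_card_mul_le {ι A μ : Type*} [Fintype ι] [DecidableEq ι] [Fintype A]
    [DecidableEq A] [Fintype μ] (hA : 0 < Fintype.card A) (r : ℕ)
    (h : Fintype.card μ * (2 ^ Fintype.card ι * Fintype.card A ^ r)
      ≤ Fintype.card A ^ Fintype.card ι) :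
    ∃ c : μ → ι → A, ∀ m m', m ≠ m' → r < hammingDist (c m) (c m') := by
  set V := 2 ^ Fintype.card ι * Fintype.card A ^ r with hV
  have hVpos : 0 < V := by positivity
  have key : ∀ M, M * V ≤ Fintype.card A ^ Fintype.card ι → ∃ S : Finset (ι → A), S.card = M ∧
      ∀ x ∈ S, ∀ y ∈ S, x ≠ y → r < hammingDist x y := by
    intro M
    induction M with
    | zero => intro _; exact ⟨∅, by simp, by simp⟩
    | succ M ih =>
      intro hM
      obtain ⟨S, hS, hdist⟩ := ih (le_trans (Nat.mul_le_mul_right _ (Nat.le_succ M)) hM)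
      have hlt : (S.biUnion fun x => Finset.univ.filter fun y => hammingDist x y ≤ r).card
          < (Finset.univ : Finset (ι → A)).card := by
        rw [Finset.card_univ, Fintype.card_fun]
        refine lt_of_le_of_lt (Finset.card_biUnion_le.trans
          (Finset.sum_le_card_nsmul _ _ V fun x _ => card_hammingBall_le hA x r)) ?_
        rw [hS, smul_eq_mul]
        refine lt_of_lt_of_le ?_ hM
        rw [Nat.succ_mul]; omega
      obtain ⟨y, -, hy⟩ := Finset.exists_mem_notMem_of_card_lt_card hlt
      have hy' : ∀ x ∈ S, r < hammingDist x y := by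
        intro x hx
        by_contra hn
        exact hy (Finset.mem_biUnion.2 ⟨x, hx, by simpa using hn⟩)
      have hyS : y ∉ S := fun hyS => by simpa using hy' y hyS
      refine ⟨insert y S, by rw [Finset.card_insert_of_notMem hyS, hS], ?_⟩
      intro x hx z hz hxz
      rcases Finset.mem_insert.1 hx with rfl | hxS <;> rcases Finset.mem_insert.1 hz with rfl | hzS
      · exact absurd rfl hxz
      · rw [hammingDist_comm]; exact hy' z hzS
      · exact hy' x hxS
      · exact hdist x hxS z hzS hxz
  obtain ⟨S, hS, hdist⟩ := key _ h
  have e : μ ≃ S := Fintype.equivOfCardEq (by simp [hS])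
  refine ⟨fun m => e m, fun m m' hm => hdist _ (e m).2 _ (e m').2 fun h => hm ?_⟩
  exact e.injective (Subtype.ext h)

/-- Rounding to the nearest of the levels `0, …, M - 1`. -/
noncomputable def quantize (M : ℕ) [NeZero M] (y : ℝ) : Fin M :=
  ⟨min (round y).toNat (M - 1), by have := NeZero.pos M; omega⟩

theorem quantize_eq {M : ℕ} [NeZero M] {y : ℝ} {j : Fin M} (h : |y - j| < 1 / 2) :
    quantize M y = j := by
  have h1 : round y = (j : ℤ) := by
    rw [round_eq, Int.floor_eq_iff]
    rw [abs_lt] at h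
    push_cast
    constructor <;> linarith [h.1, h.2]
  ext
  have := j.2
  simp only [quantize, h1, Int.toNat_natCast]
  omega

theorem measurable_quantize (M : ℕ) [NeZero M] : Measurable (quantize M) := by
  have h1 : quantize M = (fun z : ℤ => (⟨min z.toNat (M - 1), by
      have := NeZero.pos M; omega⟩ : Fin M)) ∘ fun y : ℝ => ⌊y + 1 / 2⌋ := by
    ext y
    simp only [quantize, round_eq, Function.comp]
  rw [h1]
  exact Measurable.of_discrete.comp (Int.measurable_floor.comp (by fun_prop))

/-- A block code of `s e` symbols that corrects `e` wrong symbols, each symbol being a point of a square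
constellation of `M²` points at mutual distance `g`. -/
theorem exists_blockCode_of_parameters {M s e b : ℕ} (hM : 1 ≤ M) {g a : ℝ} (hg : 0 < g)
    (ha : 0 < a) (hp : complexGaussian.real {z | a * g / 2 ≤ ‖z‖} ≤ (1 / 4) ^ s)
    (hb : 2 ^ b * (2 ^ (s * e) * (M * M) ^ (2 * e)) ≤ (M * M) ^ (s * e)) :
    ∃ (enc : (Fin b → Bool) → Fin (s * e) → ℂ)
      (dec : ℂ → (Fin (s * e) → ℂ) → Fin b → Bool), (∀ α, Measurable (dec α)) ∧
      (∀ m i, ‖enc m i‖ ^ 2 ≤ 2 * g ^ 2 * M ^ 2) ∧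
      ∀ α, a ≤ ‖α‖ → ∀ m,
        (noise (s * e)).real {w | dec α (fun i => α * enc m i + w i) ≠ m} ≤ (1 / 2) ^ (s * e) := by
  classical
  have : NeZero M := ⟨by omega⟩
  obtain ⟨c, hc⟩ := exists_code_of_card_mul_le (ι := Fin (s * e)) (A := Fin M × Fin M)
    (μ := Fin b → Bool) (by simp; omega) (2 * e) (by simpa using hb)
  let pt : Fin M × Fin M → ℂ := fun p => g * ((p.1 : ℕ) + (p.2 : ℕ) * Complex.I)
  let quant : ℂ → Fin M × Fin M := fun z => (quantize M z.re, quantize M z.im)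
  have hquant : Measurable quant :=
    ((measurable_quantize M).comp Complex.measurable_re).prodMk
      ((measurable_quantize M).comp Complex.measurable_im)
  let cor : (Fin (s * e) → Fin M × Fin M) → Fin b → Bool := fun v =>
    if h : ∃ m, hammingDist v (c m) ≤ e then h.choose else fun _ => false
  have hcor : ∀ v m, hammingDist v (c m) ≤ e → cor v = m := by
    intro v m hm
    have h : ∃ m, hammingDist v (c m) ≤ e := ⟨m, hm⟩
    simp only [cor, dif_pos h]
    by_contra hne
    have h1 := hc _ _ hne
    have h2 := hammingDist_triangle_left (c h.choose) (c m) v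
    have h3 := h.choose_spec
    omega
  refine ⟨fun m i => pt (c m i), fun α y => cor fun i => quant (y i / (α * g)), ?_, ?_, ?_⟩
  · intro α
    refine (Measurable.of_discrete (f := cor)).comp ?_
    refine measurable_pi_lambda _ fun i => hquant.comp ?_
    fun_prop
  · intro m i
    simp only [pt]
    rw [norm_mul, mul_pow, Complex.norm_real, Real.norm_eq_abs, sq_abs]
    have h1 : ∀ x y : ℕ, ‖(x : ℂ) + (y : ℂ) * Complex.I‖ ^ 2 = (x : ℝ) ^ 2 + (y : ℝ) ^ 2 := by
      intro x y
      rw [Complex.sq_norm, Complex.normSq_apply]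
      simp
      ring
    rw [h1]
    have h2 : ∀ j : Fin M, ((j : ℕ) : ℝ) ^ 2 ≤ (M : ℝ) ^ 2 := by
      intro j
      have : ((j : ℕ) : ℝ) ≤ M := by exact_mod_cast j.2.le
      gcongr
    nlinarith [h2 (c m i).1, h2 (c m i).2, sq_nonneg g]
  · intro α hα m
    have hαg : (0 : ℝ) < ‖α‖ * g := by have := ha.trans_le hα; positivity
    have hα0 : α ≠ 0 := norm_pos_iff.1 (ha.trans_le hα)
    set bad : Set ℂ := {z | a * g / 2 ≤ ‖z‖} with hbad
    have hsym : ∀ (p : Fin M × Fin M) (z : ℂ), z ∉ bad → quant ((α * pt p + z) / (α * g)) = p := by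
      intro p z hz
      have hz' : ‖z‖ < a * g / 2 := not_le.1 hz
      have hg0 : (g : ℂ) ≠ 0 := by exact_mod_cast hg.ne'
      have h1 : (α * pt p + z) / (α * g)
          = ((p.1 : ℕ) + (p.2 : ℕ) * Complex.I) + z / (α * g) := by
        simp only [pt]; field_simp
      have h2 : ‖z / (α * g)‖ < 1 / 2 := by
        rw [norm_div, norm_mul, Complex.norm_real, Real.norm_eq_abs, abs_of_pos hg,
          div_lt_iff₀ hαg]
        nlinarith
      rw [h1]
      refine Prod.ext (quantize_eq ?_) (quantize_eq ?_)
      · refine lt_of_le_of_lt ?_ h2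
        refine le_trans (le_of_eq ?_) (Complex.abs_re_le_norm _)
        simp
      · refine lt_of_le_of_lt ?_ h2
        refine le_trans (le_of_eq ?_) (Complex.abs_im_le_norm _)
        simp
    have hsub : {w : Fin (s * e) → ℂ | (cor fun i => quant ((α * pt (c m i) + w i) / (α * g))) ≠ m}
        ⊆ ⋃ S ∈ Finset.powersetCard e (Finset.univ : Finset (Fin (s * e))),
          {w | ∀ i ∈ S, w i ∈ bad} := by
      intro w hw
      have h1 : e < hammingDist (fun i => quant ((α * pt (c m i) + w i) / (α * g))) (c m) := by
        by_contra hn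
        exact hw (hcor _ _ (not_lt.1 hn))
      obtain ⟨S, hS, hScard⟩ := Finset.exists_subset_card_eq h1.le
      rw [Set.mem_iUnion₂]
      refine ⟨S, Finset.mem_powersetCard.2 ⟨Finset.subset_univ _, hScard⟩, fun i hi => ?_⟩
      by_contra hn
      have := hS hi
      rw [Finset.mem_filter] at this
      exact this.2 (hsym _ _ hn)
    have hone : ∀ S ∈ Finset.powersetCard e (Finset.univ : Finset (Fin (s * e))),
        (noise (s * e)).real {w | ∀ i ∈ S, w i ∈ bad} ≤ (1 / 4) ^ (s * e) := by
      intro S hS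
      have h1 : {w : Fin (s * e) → ℂ | ∀ i ∈ S, w i ∈ bad}
          = Set.univ.pi fun i => if i ∈ S then bad else Set.univ := by
        ext w
        simp only [Set.mem_ofPred_eq, Set.mem_pi, Set.mem_univ, true_implies]
        refine forall_congr' fun i => ?_
        by_cases hi : i ∈ S <;> simp [hi]
      rw [h1, Measure.real, noise, Measure.pi_pi, ENNReal.toReal_prod]
      have h2 : ∀ i, (complexGaussian (if i ∈ S then bad else Set.univ)).toReal
          = if i ∈ S then complexGaussian.real bad else 1 := by
        intro i; split_ifs <;> simp [Measure.real]
      simp_rw [h2]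
      rw [Finset.prod_ite_mem, Finset.univ_inter, Finset.prod_const,
        (Finset.mem_powersetCard.1 hS).2, pow_mul]
      exact pow_le_pow_left₀ measureReal_nonneg hp e
    calc _ ≤ (noise (s * e)).real (⋃ S ∈ Finset.powersetCard e
            (Finset.univ : Finset (Fin (s * e))), {w | ∀ i ∈ S, w i ∈ bad}) :=
          measureReal_mono hsub (measure_ne_top _ _)
      _ ≤ ∑ S ∈ Finset.powersetCard e (Finset.univ : Finset (Fin (s * e))),
            (noise (s * e)).real {w | ∀ i ∈ S, w i ∈ bad} :=
          measureReal_biUnion_finset_le _ _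
      _ ≤ ∑ S ∈ Finset.powersetCard e (Finset.univ : Finset (Fin (s * e))),
            ((1 : ℝ) / 4) ^ (s * e) := Finset.sum_le_sum hone
      _ ≤ 2 ^ (s * e) * (1 / 4) ^ (s * e) := by
          rw [Finset.sum_const, nsmul_eq_mul]
          refine mul_le_mul_of_nonneg_right ?_ (by positivity)
          have : (Finset.powersetCard e (Finset.univ : Finset (Fin (s * e)))).card ≤ 2 ^ (s * e) := by
            refine (Finset.card_le_univ _).trans ?_
            simp
          exact_mod_cast this
      _ = _ := by rw [← mul_pow]; norm_num

/-- Codes of rate `θ log₂ P`, for any `θ < 1`, on all links of gain at least `a`, with arbitrarily small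
probability of error for arbitrarily long messages. -/
theorem exists_blockCode {θ a A : ℝ} (hθ₀ : 0 < θ) (hθ : θ < 1) (ha : 0 < a) (hA : 0 < A) :
    ∀ᶠ P : ℝ in atTop, ∀ ε : ℝ, 0 < ε → ∀ b₀ : ℕ, ∃ b ≥ b₀, ∃ n : ℕ,
      (n : ℝ) * (θ * Real.logb 2 P) ≤ b ∧
      ∃ (enc : (Fin b → Bool) → Fin n → ℂ) (dec : ℂ → (Fin n → ℂ) → Fin b → Bool),
        (∀ α, Measurable (dec α)) ∧ (∀ m i, A * ‖enc m i‖ ^ 2 ≤ P) ∧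
        ∀ α, a ≤ ‖α‖ → ∀ m, (noise n).real {w | dec α (fun i => α * enc m i + w i) ≠ m} ≤ ε := by
  obtain ⟨s, hs⟩ := exists_nat_gt (max (3 / (1 - θ)) 3)
  have h1θ : 0 < 1 - θ := by linarith
  have hs3 : (3 : ℝ) < s := lt_of_le_of_lt (le_max_right _ _) hs
  have hsθ : 0 < s * (1 - θ) - 3 := by
    have := lt_of_le_of_lt (le_max_left _ _) hs
    rw [div_lt_iff₀ h1θ] at this
    linarith
  have hs0 : (0 : ℝ) < s := by linarith
  have hs3' : 3 < s := by exact_mod_cast hs3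
  obtain ⟨r, hr, htail⟩ := exists_complexGaussian_tail_le (ε := (1 / 4) ^ s) (by positivity)
  have hlog : Tendsto (fun P : ℝ => Real.logb 2 P) atTop atTop :=
    Real.tendsto_logb_atTop (by norm_num)
  have hpow1 := tendsto_rpow_atTop (y := 1 / (4 * (s : ℝ))) (by positivity)
  have hpow2 := tendsto_rpow_atTop (y := 1 / (2 * (s : ℝ))) (by positivity)
  filter_upwards [eventually_gt_atTop 1, hlog.eventually_ge_atTop (3 * s / (s * (1 - θ) - 3)),
    hpow1.eventually_ge_atTop (2 * r / a), hpow2.eventually_ge_atTop (2 * A)] with P hP1 hP2 hP3 hP4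
  intro ε hε b₀
  have hP0 : 0 < P := by linarith
  set x := Real.logb 2 P with hx
  have hx0 : 0 < x := Real.logb_pos (by norm_num) hP1
  have hPx : P = (2 : ℝ) ^ x := (Real.rpow_logb (by norm_num) (by norm_num) hP0).symm
  -- the number of bits per real symbol
  set κ : ℝ := (1 - 1 / s) / 2 with hκ
  have hκ0 : 0 ≤ κ := by
    have : 1 / (s : ℝ) ≤ 1 := by rw [div_le_one hs0]; linarith
    rw [hκ]; linarith
  set ℓ := ⌊κ * x⌋₊ with hℓ
  have hℓ1 : (ℓ : ℝ) ≤ κ * x := Nat.floor_le (by positivity)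
  have hℓ2 : κ * x - 1 < ℓ := Nat.sub_one_lt_floor _
  have hrate : s * (θ * x) + s ≤ 2 * ℓ * (s - 2) := by
    rw [div_le_iff₀ hsθ] at hP2
    have h1 : 2 * (κ * x - 1) * (s - 2) ≤ 2 * ℓ * (s - 2) := by
      have : (0 : ℝ) ≤ s - 2 := by linarith
      gcongr
    have h2 : 2 * (κ * x - 1) * (s - 2) = x * (s - 3 + 2 / s) - 2 * (s - 2) := by
      rw [hκ]; field_simp; ring
    have h3 : 0 ≤ x * (2 / s) := by positivity
    nlinarith
  obtain ⟨β, hβ⟩ : ∃ β : ℕ, β + s + 4 * ℓ = 2 * ℓ * s := by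
    have h1 : (s : ℝ) + 4 * ℓ ≤ 2 * ℓ * s := by
      have : 0 ≤ s * (θ * x) := by positivity
      linarith
    have h2 : s + 4 * ℓ ≤ 2 * ℓ * s := by exact_mod_cast h1
    exact ⟨_, by rw [add_assoc]; exact Nat.sub_add_cancel h2⟩
  have hβ' : (β : ℝ) + s + 4 * ℓ = 2 * ℓ * s := by exact_mod_cast hβ
  have hβx : s * (θ * x) ≤ β := by linarith
  have hβ1 : 1 ≤ β := by
    have : (0 : ℝ) < β := lt_of_lt_of_le (by positivity) hβx
    exact_mod_cast this
  obtain ⟨k, hk⟩ := exists_pow_lt_of_lt_one hε (show (1 / 2 : ℝ) < 1 by norm_num)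
  set e := max b₀ k with he
  set g : ℝ := P ^ (1 / (4 * (s : ℝ))) with hg
  have hg0 : 0 < g := Real.rpow_pos_of_pos hP0 _
  have hp : complexGaussian.real {z | a * g / 2 ≤ ‖z‖} ≤ (1 / 4) ^ s := by
    refine le_trans (measureReal_mono ?_ (measure_ne_top _ _)) htail
    intro z hz
    have hz' : a * g / 2 ≤ ‖z‖ := hz
    refine le_trans ?_ hz'
    rw [div_le_iff₀ ha] at hP3
    linarith
  have hb : 2 ^ (e * β) * (2 ^ (s * e) * (2 ^ ℓ * 2 ^ ℓ) ^ (2 * e)) ≤ (2 ^ ℓ * 2 ^ ℓ) ^ (s * e) := by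
    apply le_of_eq
    rw [← pow_add, ← pow_mul, ← pow_add, ← pow_add, ← pow_mul]
    congr 1
    calc e * β + (s * e + (ℓ + ℓ) * (2 * e)) = e * (β + s + 4 * ℓ) := by ring
      _ = _ := by rw [hβ]; ring
  obtain ⟨enc, dec, hdec, henc, herr⟩ := exists_blockCode_of_parameters (M := 2 ^ ℓ) (s := s) (e := e)
    (b := e * β) Nat.one_le_two_pow hg0 ha hp hb
  refine ⟨e * β, ?_, s * e, ?_, enc, dec, hdec, fun m i => ?_, fun α hα m => ?_⟩
  · calc b₀ ≤ e := le_max_left _ _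
      _ ≤ e * β := Nat.le_mul_of_pos_right _ hβ1
  · push_cast
    have := mul_le_mul_of_nonneg_left hβx (Nat.cast_nonneg (α := ℝ) e)
    linarith
  · have h1 : ((2 ^ ℓ : ℕ) : ℝ) ^ 2 ≤ P ^ (1 - 1 / (s : ℝ)) := by
      push_cast
      rw [hPx, ← Real.rpow_mul (by norm_num), ← pow_mul, ← Real.rpow_natCast]
      refine Real.rpow_le_rpow_of_exponent_le (by norm_num) ?_
      push_cast
      rw [hκ] at hℓ1
      linarith
    have h2 : g ^ 2 = P ^ (1 / (2 * (s : ℝ))) := by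
      rw [hg, ← Real.rpow_natCast, ← Real.rpow_mul hP0.le]
      congr 1
      push_cast
      field_simp
      norm_num
    have h3 : P ^ (1 / (2 * (s : ℝ))) * P ^ (1 / (2 * (s : ℝ))) * P ^ (1 - 1 / (s : ℝ)) = P := by
      rw [← Real.rpow_add hP0, ← Real.rpow_add hP0]
      have : 1 / (2 * (s : ℝ)) + 1 / (2 * (s : ℝ)) + (1 - 1 / (s : ℝ)) = 1 := by
        field_simp; ring
      rw [this, Real.rpow_one]
    calc A * ‖enc m i‖ ^ 2 ≤ A * (2 * g ^ 2 * ((2 ^ ℓ : ℕ) : ℝ) ^ 2) :=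
          mul_le_mul_of_nonneg_left (henc m i) hA.le
      _ ≤ A * (2 * g ^ 2 * P ^ (1 - 1 / (s : ℝ))) := by gcongr
      _ = 2 * A * (g ^ 2 * P ^ (1 - 1 / (s : ℝ))) := by ring
      _ ≤ P ^ (1 / (2 * (s : ℝ))) * (g ^ 2 * P ^ (1 - 1 / (s : ℝ))) := by gcongr
      _ = P := by rw [h2, ← mul_assoc, h3]
  · refine (herr α hα m).trans (le_trans ?_ hk.le)
    refine pow_le_pow_of_le_one (by norm_num) (by norm_num) ?_
    calc k ≤ e := le_max_right _ _
      _ ≤ s * e := Nat.le_mul_of_pos_left _ (by omega)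

/-! ### Linear one-shot schemes over the Gaussian channel -/

/-- The position in a file of `B` bits of bit `i` of packet `f`, when each packet has `B / F` bits. -/
def bitPos {F : ℕ} (B : ℕ) (f : Fin F) (i : Fin (B / F)) : Fin B :=
  ⟨f * (B / F) + i, by
    have h1 : (f + 1) * (B / F) ≤ F * (B / F) := Nat.mul_le_mul_right _ f.2
    have h2 := Nat.mul_div_le B F
    have := i.2
    rw [add_mul, one_mul] at h1
    omega⟩

theorem bitPos_surjective {F B : ℕ} (hB : F * (B / F) = B) (j : Fin B) :
    ∃ (f : Fin F) (i : Fin (B / F)), bitPos B f i = j := by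
  have hj := j.2
  have hb : 0 < B / F := by
    by_contra hn
    rw [Nat.eq_zero_of_not_pos hn, mul_zero] at hB
    omega
  refine ⟨⟨j / (B / F), ?_⟩, ⟨j % (B / F), Nat.mod_lt _ hb⟩, ?_⟩
  · rw [Nat.div_lt_iff_lt_mul hb, hB]; exact hj
  · ext
    simp only [bitPos]
    rw [mul_comm]
    exact Nat.div_add_mod _ _

/-- The bits of a packet. -/
def packetBits {N F B : ℕ} (W : Library N B) (p : Fin N × Fin F) : Fin (B / F) → Bool :=
  fun i => W p.1 (bitPos B p.2 i)

/-- The bits in a cache at which the bits of packet `p` are stored. -/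
noncomputable def cacheBits {N F B : ℕ} {S : Finset (Fin N × Fin F)}
    (z : Fin (S.card * (B / F)) → Bool) (p : S) : Fin (B / F) → Bool :=
  fun i => z (finProdFinEquiv (S.equivFin p, i))

/-- The placement of bits that stores the packets of a placement of packets. If `F` does not divide
`B`, then the last bits of each file belong to no packet. -/
noncomputable def PacketPlacement.toPlacement {K₁ K₂ N F : ℕ} {γ₁ : ℝ} (Z : PacketPlacement K₁ K₂ γ₁ N F)
    (hγ₁ : 0 ≤ γ₁) (B : ℕ) : Placement K₁ K₂ γ₁ N B where
  size k := (Z.cache k).card * (B / F)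
  size_le k := by
    have h1 := Z.card_le k
    have h2 : (F : ℝ) * ((B / F : ℕ) : ℝ) ≤ B := by exact_mod_cast Nat.mul_div_le B F
    have h3 : 0 ≤ cacheFraction γ₁ k * (N : ℝ) := by
      rcases k with k | k
      · simp only [cacheFraction, Sum.elim_inl]; positivity
      · simp [cacheFraction]
    push_cast
    calc ((Z.cache k).card : ℝ) * ((B / F : ℕ) : ℝ)
        ≤ cacheFraction γ₁ k * N * F * ((B / F : ℕ) : ℝ) := by gcongr
      _ = cacheFraction γ₁ k * N * (F * ((B / F : ℕ) : ℝ)) := by ring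
      _ ≤ _ := mul_le_mul_of_nonneg_left h2 h3
  content k W j := packetBits W ((Z.cache k).equivFin.symm (finProdFinEquiv.symm j).1).1
    (finProdFinEquiv.symm j).2

theorem PacketPlacement.isUncoded_toPlacement {K₁ K₂ N F : ℕ} {γ₁ : ℝ}
    (Z : PacketPlacement K₁ K₂ γ₁ N F) (hγ₁ : 0 ≤ γ₁) (B : ℕ) : (Z.toPlacement hγ₁ B).IsUncoded :=
  fun k => ⟨fun j =>
    let p := ((Z.cache k).equivFin.symm (finProdFinEquiv.symm j).1).1
    (p.1, bitPos B p.2 (finProdFinEquiv.symm j).2), fun _ _ => rfl⟩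

theorem cacheBits_content {K₁ K₂ N F : ℕ} {γ₁ : ℝ} (Z : PacketPlacement K₁ K₂ γ₁ N F) (hγ₁ : 0 ≤ γ₁)
    {B : ℕ} (W : Library N B) (k : User K₁ K₂) (p : Z.cache k) :
    cacheBits ((Z.toPlacement hγ₁ B).content k W) p = packetBits W p.1 := by
  ext i
  simp [cacheBits, PacketPlacement.toPlacement]

theorem chanOut_sum {L K₁ K₂ : ℕ} (h : Channel L K₁ K₂) (k : User K₁ K₂) {ι : Type*} (S : Finset ι)
    (x : ι → ℂ) (v : ι → Fin L → ℂ) :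
    chanOut h k (fun a => ∑ p ∈ S, x p * v p a) = ∑ p ∈ S, x p * chanOut h k (v p) := by
  simp only [chanOut, Finset.mul_sum]
  rw [Finset.sum_comm]
  exact Finset.sum_congr rfl fun p _ => Finset.sum_congr rfl fun a _ => by ring

/-- After subtraction of the cached packets, a served user sees its packet over a noisy scalar link. -/
theorem LinearDelivery.chanOut_eq {L K₁ K₂ N F : ℕ} {γ₁ : ℝ} {Z : PacketPlacement K₁ K₂ γ₁ N F}
    {h : Channel L K₁ K₂} {d : User K₁ K₂ → Fin N} {H : ℕ} (D : LinearDelivery Z h d H) {s : Fin H}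
    {k : User K₁ K₂} {f : Fin F} (hs : D.served s k = some f) (hc : (d k, f) ∉ Z.cache k)
    (x : Fin N × Fin F → ℂ) :
    chanOut h k (fun a => ∑ p, x p * D.beam s p a)
      - ∑ p : Z.cache k, chanOut h k (D.beam s p) * x p
      = chanOut h k (D.beam s (d k, f)) * x (d k, f) := by
  classical
  rw [chanOut_sum]
  have h1 : ∑ p, x p * chanOut h k (D.beam s p)
      = ∑ p ∈ insert (d k, f) (Z.cache k), x p * chanOut h k (D.beam s p) := by
    symm
    refine Finset.sum_subset (Finset.subset_univ _) fun p _ hp => ?_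
    rw [Finset.mem_insert, not_or] at hp
    rw [D.interference_eq_zero s k f hs p hp.1 hp.2, mul_zero]
  rw [h1, Finset.sum_insert hc, ← Finset.sum_coe_sort (Z.cache k)]
  have h2 : ∑ p : Z.cache k, chanOut h k (D.beam s p) * x p
      = ∑ p : Z.cache k, x p * chanOut h k (D.beam s p) :=
    Finset.sum_congr rfl fun p _ => mul_comm _ _
  rw [h2]; ring

theorem noise_block_real {H n : ℕ} (s : Fin H) {E : Set (Fin n → ℂ)} (hE : MeasurableSet E) :
    (noise (H * n)).real {w | (fun i => w (finProdFinEquiv (s, i))) ∈ E} = (noise n).real E := by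
  have h1 := map_pi_comp_injective (ι := Fin (H * n)) complexGaussian
    (fun i : Fin n => finProdFinEquiv (s, i)) (by
      intro i j hij
      exact (Prod.mk.inj (finProdFinEquiv.injective hij)).2)
  have h2 : noise n E = noise (H * n) {w | (fun i => w (finProdFinEquiv (s, i))) ∈ E} := by
    rw [noise, ← h1, Measure.map_apply (by fun_prop) hE]
    rfl
  rw [Measure.real, Measure.real, h2]

/-- Delivery by blocks of one code, one block per slot. -/
theorem LinearDelivery.exists_deliveryCode {L K₁ K₂ N F H B n : ℕ} {γ₁ : ℝ}
    {Z : PacketPlacement K₁ K₂ γ₁ N F} {h : Channel L K₁ K₂} {d : User K₁ K₂ → Fin N}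
    (D : LinearDelivery Z h d H) (hγ₁ : 0 ≤ γ₁) (hB : F * (B / F) = B) {a A P ε : ℝ} (hA : 0 < A)
    (ha : ∀ s k f, D.served s k = some f → a ≤ ‖chanOut h k (D.beam s (d k, f))‖)
    (hbeam : ∀ s, ∑ i, (∑ p, ‖D.beam s p i‖) ^ 2 ≤ A)
    (enc : (Fin (B / F) → Bool) → Fin n → ℂ) (dec : ℂ → (Fin n → ℂ) → Fin (B / F) → Bool)
    (hdec : ∀ α, Measurable (dec α)) (henc : ∀ m i, A * ‖enc m i‖ ^ 2 ≤ P) (hε : 0 ≤ ε)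
    (herr : ∀ α, a ≤ ‖α‖ → ∀ m,
      (noise n).real {w | dec α (fun i => α * enc m i + w i) ≠ m} ≤ ε) :
    ∃ c : DeliveryCode L (Z.toPlacement hγ₁ B) (H * n),
      c.energy ≤ ((H * n : ℕ) : ℝ) * P ∧ ∀ k, c.errorProb h d k ≤ F * ε := by
  classical
  have hslot : ∀ k f, ∃ s : (d k, f) ∉ Z.cache k → Fin H,
      ∀ hc : (d k, f) ∉ Z.cache k, D.served (s hc) k = some f := by
    intro k f
    by_cases hc : (d k, f) ∈ Z.cache k
    · exact ⟨fun hc' => absurd hc hc', fun hc' => absurd hc hc'⟩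
    · obtain ⟨s, hs⟩ := D.complete k f hc
      exact ⟨fun _ => s, fun _ => hs⟩
  choose slot hslot using hslot
  choose pf pi hpos using bitPos_surjective (F := F) hB
  let X : Library N B → Fin (H * n) → Fin L → ℂ := fun W τ i =>
    ∑ p, enc (packetBits W p) (finProdFinEquiv.symm τ).2 * D.beam (finProdFinEquiv.symm τ).1 p i
  let clean : (k : User K₁ K₂) → (Fin (H * n) → ℂ) →
      (Fin ((Z.cache k).card * (B / F)) → Bool) → Fin H → Fin n → ℂ := fun k y z s i =>
    y (finProdFinEquiv (s, i)) - ∑ p : Z.cache k, chanOut h k (D.beam s p) * enc (cacheBits z p) i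
  let decoder : (k : User K₁ K₂) → (Fin (H * n) → ℂ) →
      (Fin ((Z.cache k).card * (B / F)) → Bool) → Fin F → Fin (B / F) → Bool := fun k y z f =>
    if hc : (d k, f) ∈ Z.cache k then cacheBits z ⟨_, hc⟩
    else dec (chanOut h k (D.beam (slot k f hc) (d k, f))) (clean k y z (slot k f hc))
  have hmeas : ∀ k z f, Measurable fun y => decoder k y z f := by
    intro k z f
    by_cases hc : (d k, f) ∈ Z.cache k
    · simp only [decoder, dif_pos hc]; exact measurable_const
    · simp only [decoder, dif_neg hc]
      refine (hdec _).comp (measurable_pi_lambda _ fun i => ?_)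
      exact (measurable_pi_apply _).sub measurable_const
  let c : DeliveryCode L (Z.toPlacement hγ₁ B) (H * n) :=
    { enc := X
      dec := fun k y z j => decoder k y z (pf j) (pi j)
      measurable_dec := fun k z => measurable_pi_lambda _ fun j =>
        (measurable_pi_apply (pi j)).comp (hmeas k z (pf j)) }
  have hcard : (0 : ℝ) < Fintype.card (Library N B) := by exact_mod_cast Fintype.card_pos
  refine ⟨c, ?_, fun k => ?_⟩
  · rw [DeliveryCode.energy, div_le_iff₀ hcard]
    have h1 : ∀ W τ, ∑ i, ‖c.enc W τ i‖ ^ 2 ≤ P := by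
      intro W τ
      set s := (finProdFinEquiv.symm τ).1
      set j := (finProdFinEquiv.symm τ).2
      have h2 : ∀ m, ‖enc m j‖ ≤ √(P / A) := by
        intro m
        apply Real.le_sqrt_of_sq_le
        rw [le_div_iff₀ hA, mul_comm]
        exact henc m j
      have hP : 0 ≤ P / A := by
        have := henc (fun _ => false) j
        have h0 : 0 ≤ A * ‖enc (fun _ => false) j‖ ^ 2 := by positivity
        exact div_nonneg (h0.trans this) hA.le
      calc ∑ i, ‖c.enc W τ i‖ ^ 2 ≤ ∑ i, (√(P / A) * ∑ p, ‖D.beam s p i‖) ^ 2 := by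
            refine Finset.sum_le_sum fun i _ => ?_
            gcongr
            refine (norm_sum_le _ _).trans ?_
            rw [Finset.mul_sum]
            refine Finset.sum_le_sum fun p _ => ?_
            rw [norm_mul]
            exact mul_le_mul_of_nonneg_right (h2 _) (norm_nonneg _)
        _ = P / A * ∑ i, (∑ p, ‖D.beam s p i‖) ^ 2 := by
            rw [Finset.mul_sum]
            exact Finset.sum_congr rfl fun i _ => by rw [mul_pow, Real.sq_sqrt hP]
        _ ≤ P / A * A := mul_le_mul_of_nonneg_left (hbeam s) hP
        _ = P := div_mul_cancel₀ _ hA.ne'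
    calc ∑ W, ∑ τ, ∑ i, ‖c.enc W τ i‖ ^ 2 ≤ ∑ W : Library N B, ∑ τ : Fin (H * n), P :=
          Finset.sum_le_sum fun W _ => Finset.sum_le_sum fun τ _ => h1 W τ
      _ = _ := by
          simp only [Finset.sum_const, Finset.card_univ, nsmul_eq_mul, Fintype.card_fin]
          ring
  · rw [DeliveryCode.errorProb, div_le_iff₀ hcard]
    have hW : ∀ W, (noise (H * n)).real {w | c.dec k (c.received h k W w)
        ((Z.toPlacement hγ₁ B).content k W) ≠ W (d k)} ≤ F * ε := by
      intro W
      set z := (Z.toPlacement hγ₁ B).content k W with hz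
      let E : Fin F → Set (Fin (H * n) → ℂ) := fun f =>
        {w | decoder k (c.received h k W w) z f ≠ packetBits W (d k, f)}
      have hsub : {w | c.dec k (c.received h k W w) z ≠ W (d k)} ⊆ ⋃ f ∈ Finset.univ, E f := by
        intro w hw
        by_contra hn
        apply hw
        ext j
        have h1 : decoder k (c.received h k W w) z (pf j) = packetBits W (d k, pf j) := by
          by_contra h2
          exact hn (Set.mem_iUnion₂.2 ⟨pf j, Finset.mem_univ _, h2⟩)
        have h2 := congrFun h1 (pi j)
        rw [packetBits, hpos] at h2
        exact h2
      have hE : ∀ f, (noise (H * n)).real (E f) ≤ ε := by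
        intro f
        by_cases hc : (d k, f) ∈ Z.cache k
        · have : E f = ∅ := by
            ext w
            simp only [E, decoder, dif_pos hc, Set.mem_ofPred_eq, Set.mem_empty_iff_false, iff_false,
              not_not, hz]
            exact cacheBits_content Z hγ₁ W k ⟨_, hc⟩
          rw [this]; simpa using hε
        · set s := slot k f hc with hs
          have hsv := hslot k f hc
          set α := chanOut h k (D.beam s (d k, f)) with hα
          set m := packetBits W (d k, f) with hm
          have hclean : ∀ w, clean k (c.received h k W w) z s
              = fun i => α * enc m i + w (finProdFinEquiv (s, i)) := by
            intro w
            ext i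
            have h1 := D.chanOut_eq hsv hc (fun p => enc (packetBits W p) i)
            simp only [clean, DeliveryCode.received, c, X, Equiv.symm_apply_apply]
            rw [hα, hm, ← h1]
            have h2 : ∀ p : Z.cache k, cacheBits z p = packetBits W p.1 := fun p =>
              cacheBits_content Z hγ₁ W k p
            simp only [h2]
            ring
          have h3 : E f = {w | (fun i => w (finProdFinEquiv (s, i))) ∈
              {v : Fin n → ℂ | dec α (fun i => α * enc m i + v i) ≠ m}} := by
            ext w
            simp only [E, decoder, dif_neg hc, Set.mem_ofPred_eq]
            rw [← hs, hclean]
          rw [h3, noise_block_real]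
          · exact herr α (ha s k f hsv) m
          · have hme : Measurable fun v : Fin n → ℂ => dec α (fun i => α * enc m i + v i) := by
              refine (hdec α).comp ?_
              fun_prop
            exact (hme (measurableSet_singleton m)).compl
      calc _ ≤ (noise (H * n)).real (⋃ f ∈ Finset.univ, E f) :=
            measureReal_mono hsub (measure_ne_top _ _)
        _ ≤ ∑ f, (noise (H * n)).real (E f) := measureReal_biUnion_finset_le _ _
        _ ≤ ∑ f : Fin F, ε := Finset.sum_le_sum fun f _ => hE f
        _ = F * ε := by simp
    calc _ ≤ ∑ W : Library N B, F * ε := Finset.sum_le_sum fun W _ => hW W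
      _ = _ := by simp only [Finset.sum_const, Finset.card_univ, nsmul_eq_mul]; ring

theorem exists_pos_forall_le {ι : Type*} [Finite ι] (f : ι → ℝ) (hf : ∀ i, 0 < f i) :
    ∃ a, 0 < a ∧ ∀ i, a ≤ f i := by
  have h1 : ∀ᶠ a in nhdsWithin (0 : ℝ) (Set.Ioi 0), ∀ i, a ≤ f i :=
    eventually_all.2 fun i => nhdsWithin_le_nhds (eventually_le_nhds (hf i))
  obtain ⟨a, ha, ha'⟩ := ((eventually_mem_nhdsWithin (s := Set.Ioi (0 : ℝ))).and h1).exists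
  exact ⟨a, ha, ha'⟩

theorem exists_forall_le {ι : Type*} [Finite ι] (f : ι → ℝ) : ∃ A, 0 < A ∧ ∀ i, f i ≤ A := by
  have h1 : ∀ᶠ A in atTop, ∀ i, f i ≤ A := eventually_all.2 fun i => eventually_ge_atTop _
  obtain ⟨A, hA, hA'⟩ := ((eventually_gt_atTop 0).and h1).exists
  exact ⟨A, hA, hA'⟩

theorem LinearOneShotAchievable.uncodedAchievable {L K₁ K₂ N : ℕ} {γ₁ T : ℝ} (hγ₁ : 0 ≤ γ₁)
    (hT : 0 ≤ T) {𝓗 : Set (Channel L K₁ K₂)} (hach : LinearOneShotAchievable γ₁ N 𝓗 T) :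
    UncodedAchievable γ₁ N 𝓗 T := by
  classical
  obtain ⟨F, hF, Z, hZ⟩ := hach
  intro δ hδ
  refine ⟨fun _ B => Z.toPlacement hγ₁ B, fun _ B => Z.isUncoded_toPlacement hγ₁ B, fun h hh => ?_⟩
  have hZ' : ∀ d : {d : User K₁ K₂ → Fin N // Function.Injective d},
      ∃ H : ℕ, (H : ℝ) ≤ T * F ∧ Nonempty (LinearDelivery Z h d.1 H) := fun d => hZ h hh d.1 d.2
  choose H hH D using hZ'
  have D := fun d => (D d).some
  obtain ⟨a, ha, ha'⟩ := exists_pos_forall_le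
    (fun x : Σ d, Fin (H d) × User K₁ K₂ × Fin F =>
      if (D x.1).served x.2.1 x.2.2.1 = some x.2.2.2 then
        ‖chanOut h x.2.2.1 ((D x.1).beam x.2.1 (x.1.1 x.2.2.1, x.2.2.2))‖ else 1) (by
      rintro ⟨d, s, k, f⟩
      by_cases hs : (D d).served s k = some f
      · simp only [hs, if_true]; exact norm_pos_iff.2 ((D d).wanted_ne_zero s k f hs)
      · simp only [hs, if_false]; exact one_pos)
  obtain ⟨A, hA, hA'⟩ := exists_forall_le
    (fun x : Σ d, Fin (H d) => ∑ i, (∑ p, ‖(D x.1).beam x.2 p i‖) ^ 2)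
  set θ := (T + δ / 2) / (T + δ) with hθ
  have hTδ : 0 < T + δ := by linarith
  have hθ0 : 0 < θ := by positivity
  have hθ1 : θ < 1 := by rw [hθ, div_lt_one hTδ]; linarith
  have hθT : T ≤ (T + δ) * θ := by rw [hθ, mul_div_cancel₀ _ hTδ.ne']; linarith
  filter_upwards [exists_blockCode hθ0 hθ1 ha hA, eventually_gt_atTop 1] with P hP hP1 ε hε
  rw [frequently_atTop]
  intro B₀
  have hF' : (0 : ℝ) < F := by exact_mod_cast hF
  obtain ⟨b, hb, n, hn, enc, dec, hdec, henc, herr⟩ := hP (ε / F) (by positivity) B₀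
  obtain ⟨B, hB1, hB2⟩ : ∃ B, B / F = b ∧ F * (B / F) = B :=
    ⟨F * b, Nat.mul_div_cancel_left _ hF, by rw [Nat.mul_div_cancel_left _ hF]⟩
  subst hB1
  refine ⟨B, hb.trans (Nat.div_le_self _ _), fun d hd => ?_⟩
  obtain ⟨c, hc1, hc2⟩ := (D ⟨d, hd⟩).exists_deliveryCode hγ₁ hB2 (a := a) (A := A) (P := P)
    (ε := ε / F) hA (fun s k f hs => by simpa [hs] using ha' ⟨⟨d, hd⟩, s, k, f⟩)
    (fun s => hA' ⟨⟨d, hd⟩, s⟩) enc dec hdec henc (by positivity) herr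
  refine ⟨_, c, ?_, hc1, fun k => (hc2 k).trans (mul_div_cancel₀ _ hF'.ne').le⟩
  have hlog : 0 < Real.logb 2 P := Real.logb_pos (by norm_num) hP1
  have hB2' : (F : ℝ) * ((B / F : ℕ) : ℝ) = B := by exact_mod_cast hB2
  push_cast
  calc (H ⟨d, hd⟩ : ℝ) * n * Real.logb 2 P ≤ T * F * n * Real.logb 2 P := by
        have := hH ⟨d, hd⟩
        gcongr
    _ = T * (F * (n * Real.logb 2 P)) := by ring
    _ ≤ (T + δ) * θ * (F * (n * Real.logb 2 P)) := by gcongr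
    _ = (T + δ) * (F * (n * (θ * Real.logb 2 P))) := by ring
    _ ≤ (T + δ) * (F * ((B / F : ℕ) : ℝ)) := by gcongr
    _ = _ := by rw [hB2']

theorem UncodedAchievable.achievable {L K₁ K₂ N : ℕ} {γ₁ T : ℝ} {𝓗 : Set (Channel L K₁ K₂)}
    (h : UncodedAchievable γ₁ N 𝓗 T) : Achievable γ₁ N 𝓗 T := by
  intro δ hδ
  obtain ⟨Z, -, hZ⟩ := h δ hδ
  exact ⟨Z, fun _ _ => trivial, hZ⟩

/-! ### Information-theoretic converse -/

theorem norm_add_sq_le (a b : ℂ) : ‖a + b‖ ^ 2 ≤ 2 * ‖a‖ ^ 2 + 2 * ‖b‖ ^ 2 := by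
  have h1 := norm_add_le a b
  have h2 : ‖a + b‖ ^ 2 ≤ (‖a‖ + ‖b‖) ^ 2 := by gcongr
  nlinarith [sq_nonneg (‖a‖ - ‖b‖)]

theorem norm_chanOut_sq_le {L K₁ K₂ : ℕ} (h : Channel L K₁ K₂) (k : User K₁ K₂) (x : Fin L → ℂ) :
    ‖chanOut h k x‖ ^ 2 ≤ (∑ a, ‖h k a‖ ^ 2) * ∑ a, ‖x a‖ ^ 2 := by
  have h1 : ‖chanOut h k x‖ ≤ ∑ a, ‖h k a‖ * ‖x a‖ := by
    refine (norm_sum_le _ _).trans (le_of_eq ?_)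
    exact Finset.sum_congr rfl fun a _ => by rw [norm_mul, norm_star]
  calc ‖chanOut h k x‖ ^ 2 ≤ (∑ a, ‖h k a‖ * ‖x a‖) ^ 2 := by gcongr
    _ ≤ _ := Finset.sum_mul_sq_le_sq_mul_sq _ _ _

theorem chanOut_add {L K₁ K₂ : ℕ} (h : Channel L K₁ K₂) (k : User K₁ K₂) (x y : Fin L → ℂ) :
    chanOut h k (fun a => x a + y a) = chanOut h k x + chanOut h k y := by
  simp only [chanOut, mul_add, Finset.sum_add_distrib]

/-- Signals `y` at the antennas of bounded energy, together with signals at the users close to those that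
`y` causes. -/
def typicalRegion {L K₁ K₂ : ℕ} (h : Channel L K₁ K₂) (n : ℕ) (ρ₁ ρ₂ : ℝ) :
    Set ((Fin L × Fin n → ℂ) × (User K₁ K₂ × Fin n → ℂ)) :=
  {p | ∑ i, ‖p.1 i‖ ^ 2 ≤ Fintype.card (Fin L × Fin n) * ρ₁ ∧
    ∑ j, ‖p.2 j - chanOut h j.1 (fun a => p.1 (a, j.2))‖ ^ 2
      ≤ Fintype.card (User K₁ K₂ × Fin n) * ρ₂}

/-- The signals of the users add no volume that grows with the power: they lie in a ball of constant
radius around a point determined by the signal at the `L` antennas. -/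
theorem volume_typicalRegion_le {L K₁ K₂ : ℕ} (h : Channel L K₁ K₂) (n : ℕ) {ρ₁ ρ₂ : ℝ}
    (h₁ : 0 ≤ ρ₁) (h₂ : 0 ≤ ρ₂) :
    volume (typicalRegion h n ρ₁ ρ₂) ≤
      ENNReal.ofReal ((Real.pi * Real.exp 1 * ρ₁) ^ (L * n) *
        (Real.pi * Real.exp 1 * ρ₂) ^ ((K₁ + K₂) * n)) := by
  have hc1 : Fintype.card (Fin L × Fin n) = L * n := by simp
  have hc2 : Fintype.card (User K₁ K₂ × Fin n) = (K₁ + K₂) * n := by simp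
  have hb1 := volume_ball_le (ι := Fin L × Fin n) h₁
  have hb2 := volume_ball_le (ι := User K₁ K₂ × Fin n) h₂
  rw [hc1] at hb1
  rw [hc2] at hb2
  set B₁ : Set (Fin L × Fin n → ℂ) := {x | ∑ i, ‖x i‖ ^ 2 ≤ ((L * n : ℕ) : ℝ) * ρ₁} with hB₁
  set B₂ : Set (User K₁ K₂ × Fin n → ℂ) := {x | ∑ i, ‖x i‖ ^ 2 ≤ (((K₁ + K₂) * n : ℕ) : ℝ) * ρ₂}
    with hB₂
  have hmeasB₁ : MeasurableSet B₁ := measurableSet_le (by fun_prop) (by fun_prop)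
  have hmeas : MeasurableSet (typicalRegion h n ρ₁ ρ₂) := by
    unfold typicalRegion chanOut
    measurability
  rw [Measure.volume_eq_prod, Measure.prod_apply hmeas]
  have hsec : ∀ y, volume (Prod.mk y ⁻¹' typicalRegion h n ρ₁ ρ₂)
      ≤ B₁.indicator (fun _ => volume B₂) y := by
    intro y
    by_cases hy : y ∈ B₁
    · rw [Set.indicator_of_mem hy]
      have hsub : Prod.mk y ⁻¹' typicalRegion h n ρ₁ ρ₂ ⊆
          (fun z => z + fun j => -chanOut h j.1 (fun a => y (a, j.2))) ⁻¹' B₂ := by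
        intro z hz
        have hz2 := hz.2
        rw [hc2] at hz2
        simpa only [hB₂, Set.mem_preimage, Set.mem_ofPred_eq, Pi.add_apply, ← sub_eq_add_neg]
          using hz2
      refine (measure_mono hsub).trans (le_of_eq ?_)
      rw [measure_preimage_add_right]
    · have : Prod.mk y ⁻¹' typicalRegion h n ρ₁ ρ₂ = ∅ := by
        ext z
        simp only [Set.mem_preimage, Set.mem_empty_iff_false, iff_false]
        intro hz
        have hz1 := hz.1
        rw [hc1] at hz1
        exact hy hz1
      rw [this, measure_empty]; exact zero_le
  calc _ ≤ ∫⁻ y, B₁.indicator (fun _ => volume B₂) y := lintegral_mono hsec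
    _ = volume B₂ * volume B₁ := by rw [lintegral_indicator hmeasB₁, setLIntegral_const]
    _ ≤ _ := by
      rw [mul_comm, ENNReal.ofReal_mul (by positivity)]
      gcongr

/-- The counting bound behind the converse. Each user could decode from a noisy observation of the signals
at the antennas together with those at all users. Typical observations fill a region whose volume grows
with the power like `P ^ (L n)` only, and the density of the noise is at most `1`; so no more than
about `L n log₂ P` bits can be told apart. The bits outside `𝒰` are given to all users; any two libraries that
differ only in `𝒰` must be told apart by some user. -/
theorem DeliveryCode.two_pow_card_le {L K₁ K₂ N B n : ℕ} {γ₁ : ℝ} {Z : Placement K₁ K₂ γ₁ N B}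
    (c : DeliveryCode L Z n) (h : Channel L K₁ K₂) (d : User K₁ K₂ → Fin N) (hL : 1 ≤ L)
    (hK : 1 ≤ K₁ + K₂) {P ε : ℝ} (hP : 1 ≤ P) (henergy : c.energy ≤ n * P)
    (hε : ((K₁ + K₂ : ℕ) : ℝ) * ε ≤ 1 / 4) (herr : ∀ k, c.errorProb h d k ≤ ε)
    (𝒰 : Finset (Fin N × Fin B))
    (hdet : ∀ W W' : Library N B, W ≠ W' → (∀ p ∉ 𝒰, W p.1 p.2 = W' p.1 p.2) →
      ∃ k, Z.content k W = Z.content k W' ∧ W (d k) ≠ W' (d k)) :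
    (2 : ℝ) ^ 𝒰.card ≤ 4 * ((Real.pi * Real.exp 1 * (24 * P)) ^ (L * n) *
      (Real.pi * Real.exp 1 * (16 + 16 * L * ∑ k, ∑ a, ‖h k a‖ ^ 2)) ^ ((K₁ + K₂) * n)) := by
  classical
  set Hsq := ∑ k, ∑ a, ‖h k a‖ ^ 2 with hHsq
  have hHsq0 : 0 ≤ Hsq := by positivity
  set R := typicalRegion h n (24 * P) (16 + 16 * L * Hsq) with hR
  have hvol := volume_typicalRegion_le h n (ρ₁ := 24 * P) (ρ₂ := 16 + 16 * L * Hsq) (by positivity)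
    (by positivity)
  set V : ℝ := (Real.pi * Real.exp 1 * (24 * P)) ^ (L * n) *
      (Real.pi * Real.exp 1 * (16 + 16 * L * Hsq)) ^ ((K₁ + K₂) * n) with hV
  have hV0 : 0 ≤ V := by positivity
  set μ₁ := Measure.pi fun _ : Fin L × Fin n => complexGaussian with hμ₁
  set μ₂ := Measure.pi fun _ : User K₁ K₂ × Fin n => complexGaussian with hμ₂
  have hμvol : μ₁.prod μ₂ ≤ volume :=
    Measure.prod_mono (pi_le_pi complexGaussian_le_volume) (pi_le_pi complexGaussian_le_volume)
  have hL' : (1 : ℝ) ≤ L := by exact_mod_cast hL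
  have hK' : (1 : ℝ) ≤ ((K₁ + K₂ : ℕ) : ℝ) := by exact_mod_cast hK
  have hc1 : (Fintype.card (Fin L × Fin n) : ℝ) = L * n := by simp
  have hc2 : (Fintype.card (User K₁ K₂ × Fin n) : ℝ) = ((K₁ + K₂ : ℕ) : ℝ) * n := by simp
  -- decoding of user `k` fails
  let Bad : Library N B → (k : User K₁ K₂) → Set (Fin n → ℂ) := fun W k =>
    {w | c.dec k (c.received h k W w) (Z.content k W) ≠ W (d k)}
  have hBad : ∀ W k, MeasurableSet (Bad W k) := by
    intro W k
    have : Measurable fun w => c.dec k (c.received h k W w) (Z.content k W) := by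
      refine (c.measurable_dec k _).comp ?_
      unfold DeliveryCode.received
      fun_prop
    exact (this (measurableSet_singleton _)).compl
  let A₁ : Set (Fin L × Fin n → ℂ) := {u | 8 * (Fintype.card (Fin L × Fin n) : ℝ) < ∑ i, ‖u i‖ ^ 2}
  let A₂ : Set (User K₁ K₂ × Fin n → ℂ) :=
    {u | 8 * (Fintype.card (User K₁ K₂ × Fin n) : ℝ) < ∑ i, ‖u i‖ ^ 2}
  have hA₁ : MeasurableSet A₁ := measurableSet_lt (by fun_prop) (by fun_prop)
  have hA₂ : MeasurableSet A₂ := measurableSet_lt (by fun_prop) (by fun_prop)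
  have hpA₁ : μ₁.real A₁ ≤ 1 / 8 := pi_complexGaussian_energy_le (by norm_num)
  have hpA₂ : μ₂.real A₂ ≤ 1 / 8 := pi_complexGaussian_energy_le (by norm_num)
  let F : Library N B → Set ((Fin L × Fin n → ℂ) × (User K₁ K₂ × Fin n → ℂ)) := fun W =>
    Prod.fst ⁻¹' A₁ ∪ Prod.snd ⁻¹' A₂ ∪
      ⋃ k ∈ Finset.univ, (fun p => fun s => p.2 (k, s)) ⁻¹' Bad W k
  have hFmeas : ∀ W, MeasurableSet (F W) := by
    intro W
    refine ((measurable_fst hA₁).union (measurable_snd hA₂)).union ?_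
    refine Finset.measurableSet_biUnion _ fun k _ => ?_
    have : Measurable fun p : (Fin L × Fin n → ℂ) × (User K₁ K₂ × Fin n → ℂ) =>
        fun s => p.2 (k, s) := by fun_prop
    exact this (hBad W k)
  have hF : ∀ W, (μ₁.prod μ₂).real (F W) ≤ 1 / 4 + ∑ k, (noise n).real (Bad W k) := by
    intro W
    have h1 : (μ₁.prod μ₂).real (Prod.fst ⁻¹' A₁) ≤ 1 / 8 := by
      rw [Measure.real, (measurePreserving_fst (μ := μ₁) (ν := μ₂)).measure_preimage
        hA₁.nullMeasurableSet]
      exact hpA₁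
    have h2 : (μ₁.prod μ₂).real (Prod.snd ⁻¹' A₂) ≤ 1 / 8 := by
      rw [Measure.real, (measurePreserving_snd (μ := μ₁) (ν := μ₂)).measure_preimage
        hA₂.nullMeasurableSet]
      exact hpA₂
    have h3 : ∀ k, (μ₁.prod μ₂).real ((fun p => fun s => p.2 (k, s)) ⁻¹' Bad W k)
        = (noise n).real (Bad W k) := by
      intro k
      have hmp : MeasurePreserving (fun (w : User K₁ K₂ × Fin n → ℂ) (s : Fin n) => w (k, s)) μ₂
          (noise n) := ⟨by fun_prop, map_pi_comp_injective complexGaussian (fun s => (k, s))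
            (fun _ _ hs => (Prod.mk.inj hs).2)⟩
      have := (hmp.comp (measurePreserving_snd (μ := μ₁) (ν := μ₂))).measure_preimage
        (hBad W k).nullMeasurableSet
      rw [Measure.real, Measure.real, ← this]
      rfl
    calc _ ≤ (μ₁.prod μ₂).real (Prod.fst ⁻¹' A₁ ∪ Prod.snd ⁻¹' A₂) + (μ₁.prod μ₂).real
          (⋃ k ∈ Finset.univ, (fun p => fun s => p.2 (k, s)) ⁻¹' Bad W k) := measureReal_union_le _ _
      _ ≤ ((μ₁.prod μ₂).real (Prod.fst ⁻¹' A₁) + (μ₁.prod μ₂).real (Prod.snd ⁻¹' A₂)) +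
          ∑ k, (μ₁.prod μ₂).real ((fun p => fun s => p.2 (k, s)) ⁻¹' Bad W k) :=
        add_le_add (measureReal_union_le _ _) (measureReal_biUnion_finset_le _ _)
      _ ≤ _ := by rw [Finset.sum_congr rfl fun k _ => h3 k]; linarith
  -- libraries whose codeword has at most four times the average energy
  set G := Finset.univ.filter fun W : Library N B => ∑ s, ∑ a, ‖c.enc W s a‖ ^ 2 ≤ 4 * (n * P)
    with hG
  set M : ℝ := (Fintype.card (Library N B) : ℝ) with hM
  have hMpos : 0 < M := by rw [hM]; exact_mod_cast Fintype.card_pos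
  have hGcard : 3 / 4 * M ≤ G.card := by
    rcases Nat.eq_zero_or_pos n with hn | hn
    · have : G = Finset.univ := by
        subst hn
        rw [hG, Finset.filter_true_of_mem]
        intro W _
        simp
      rw [this, Finset.card_univ]; linarith
    · have hnP : 0 < (n : ℝ) * P := by
        have : (0 : ℝ) < n := by exact_mod_cast hn
        positivity
      rw [DeliveryCode.energy, div_le_iff₀ hMpos] at henergy
      have h1 : ((Finset.univ.filter fun W : Library N B =>
          ¬ ∑ s, ∑ a, ‖c.enc W s a‖ ^ 2 ≤ 4 * (n * P)).card : ℝ) * (4 * (n * P))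
          ≤ ∑ W : Library N B, ∑ s, ∑ a, ‖c.enc W s a‖ ^ 2 := by
        rw [← nsmul_eq_mul, ← Finset.sum_const]
        refine (Finset.sum_le_sum fun W hW => ?_).trans
          (Finset.sum_le_sum_of_subset_of_nonneg (Finset.filter_subset _ _) fun W _ _ => by positivity)
        exact (not_le.1 (Finset.mem_filter.1 hW).2).le
      have h2 := Finset.card_filter_add_card_filter_not (s := (Finset.univ : Finset (Library N B)))
        (fun W => ∑ s, ∑ a, ‖c.enc W s a‖ ^ 2 ≤ 4 * (n * P))
      rw [Finset.card_univ, ← hG] at h2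
      have h3 : (G.card : ℝ) + ((Finset.univ.filter fun W : Library N B =>
          ¬ ∑ s, ∑ a, ‖c.enc W s a‖ ^ 2 ≤ 4 * (n * P)).card : ℝ) = M := by
        rw [hM]; exact_mod_cast h2
      nlinarith
  have hlower : M / 4 ≤ ∑ W ∈ G, (μ₁.prod μ₂).real (F W)ᶜ := by
    have h1 : ∀ W, 3 / 4 - ∑ k, (noise n).real (Bad W k) ≤ (μ₁.prod μ₂).real (F W)ᶜ := by
      intro W
      rw [probReal_compl_eq_one_sub (hFmeas W)]
      linarith [hF W]
    have h2 : ∑ W ∈ G, ∑ k, (noise n).real (Bad W k) ≤ M * (1 / 4) := by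
      calc _ ≤ ∑ W, ∑ k, (noise n).real (Bad W k) :=
            Finset.sum_le_sum_of_subset_of_nonneg (Finset.subset_univ _) fun W _ _ =>
              Finset.sum_nonneg fun k _ => measureReal_nonneg
        _ = ∑ k, ∑ W, (noise n).real (Bad W k) := Finset.sum_comm
        _ ≤ ∑ k : User K₁ K₂, ε * M := Finset.sum_le_sum fun k _ => by
            have := herr k
            rw [DeliveryCode.errorProb, div_le_iff₀ hMpos] at this
            exact this
        _ = M * (((K₁ + K₂ : ℕ) : ℝ) * ε) := by simp; ring
        _ ≤ _ := mul_le_mul_of_nonneg_left hε hMpos.le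
    have h3 := Finset.sum_le_sum fun W (_ : W ∈ G) => h1 W
    rw [Finset.sum_sub_distrib, Finset.sum_const, nsmul_eq_mul] at h3
    linarith
  -- the typical observations for which all users decode correctly
  let shift : Library N B → (Fin L × Fin n → ℂ) × (User K₁ K₂ × Fin n → ℂ) := fun W =>
    (fun i => -c.enc W i.2 i.1, fun j => -chanOut h j.1 (c.enc W j.2))
  let D : Library N B → Set ((Fin L × Fin n → ℂ) × (User K₁ K₂ × Fin n → ℂ)) := fun W =>
    (fun p => p + shift W) ⁻¹' (F W)ᶜ
  have hDmeas : ∀ W, MeasurableSet (D W) := fun W =>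
    (measurable_add_const (shift W)) (hFmeas W).compl
  have hDvol : ∀ W, ENNReal.ofReal ((μ₁.prod μ₂).real (F W)ᶜ) ≤ volume (D W) := by
    intro W
    have hmp : MeasurePreserving (fun p => p + shift W)
        (volume : Measure ((Fin L × Fin n → ℂ) × (User K₁ K₂ × Fin n → ℂ))) volume :=
      (measurePreserving_add_right volume (shift W).1).prod
        (measurePreserving_add_right volume (shift W).2)
    rw [ofReal_measureReal, hmp.measure_preimage (hFmeas W).compl.nullMeasurableSet]
    exact hμvol _
  have hmemD : ∀ W p, p ∈ D W → (∑ i, ‖(p + shift W).1 i‖ ^ 2 ≤ 8 * (L * n)) ∧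
      (∑ j, ‖(p + shift W).2 j‖ ^ 2 ≤ 8 * (((K₁ + K₂ : ℕ) : ℝ) * n)) ∧
      ∀ k, c.dec k (fun s => p.2 (k, s)) (Z.content k W) = W (d k) := by
    intro W p hp
    have hp' : p + shift W ∉ F W := hp
    simp only [F, Set.mem_union, not_or, Set.mem_preimage, Set.mem_iUnion₂, not_exists] at hp'
    obtain ⟨⟨h1, h2⟩, h3⟩ := hp'
    refine ⟨?_, ?_, fun k => ?_⟩
    · rw [← hc1]; exact not_lt.1 h1
    · rw [← hc2]; exact not_lt.1 h2
    · have h4 := not_not.1 (h3 k (Finset.mem_univ k))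
      have h5 : c.received h k W (fun s => (p + shift W).2 (k, s)) = fun s => p.2 (k, s) := by
        ext s
        simp [DeliveryCode.received, shift]
      rwa [h5] at h4
  have hDR : ∀ W ∈ G, D W ⊆ R := by
    intro W hW p hp
    obtain ⟨h1, h2, -⟩ := hmemD W p hp
    have hWG := (Finset.mem_filter.1 hW).2
    set q := p + shift W with hq
    have hp1 : ∀ i, p.1 i = q.1 i + c.enc W i.2 i.1 := by intro i; simp [hq, shift]
    have hp2 : ∀ j, p.2 j = q.2 j + chanOut h j.1 (c.enc W j.2) := by intro j; simp [hq, shift]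
    have hn0 : (0 : ℝ) ≤ n := Nat.cast_nonneg _
    constructor
    · rw [hc1]
      calc ∑ i, ‖p.1 i‖ ^ 2 ≤ ∑ i, (2 * ‖q.1 i‖ ^ 2 + 2 * ‖c.enc W i.2 i.1‖ ^ 2) :=
            Finset.sum_le_sum fun i _ => by rw [hp1]; exact norm_add_sq_le _ _
        _ = 2 * ∑ i, ‖q.1 i‖ ^ 2 + 2 * ∑ s, ∑ a, ‖c.enc W s a‖ ^ 2 := by
            rw [Finset.sum_add_distrib, ← Finset.mul_sum, ← Finset.mul_sum]
            congr 2
            rw [Fintype.sum_prod_type, Finset.sum_comm]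
        _ ≤ 2 * (8 * (L * n)) + 2 * (4 * (n * P)) := by gcongr
        _ ≤ L * n * (24 * P) := by
            have h3 : (n : ℝ) * 1 ≤ n * P := mul_le_mul_of_nonneg_left hP hn0
            have h4 : (1 : ℝ) * (n * P) ≤ L * (n * P) := by gcongr
            have h5 : (L : ℝ) * (n * 1) ≤ L * (n * P) := by gcongr
            nlinarith
    · rw [hc2]
      have h3 : ∀ j : User K₁ K₂ × Fin n, p.2 j - chanOut h j.1 (fun a => p.1 (a, j.2))
          = q.2 j + -chanOut h j.1 (fun a => q.1 (a, j.2)) := by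
        intro j
        simp only [hp1, hp2, chanOut_add]
        ring
      calc _ ≤ ∑ j : User K₁ K₂ × Fin n,
              (2 * ‖q.2 j‖ ^ 2 + 2 * ‖chanOut h j.1 (fun a => q.1 (a, j.2))‖ ^ 2) :=
            Finset.sum_le_sum fun j _ => by
              rw [h3, ← norm_neg (chanOut h j.1 fun a => q.1 (a, j.2))]
              exact norm_add_sq_le _ _
        _ ≤ ∑ j : User K₁ K₂ × Fin n, (2 * ‖q.2 j‖ ^ 2 +
              2 * ((∑ a, ‖h j.1 a‖ ^ 2) * ∑ a, ‖q.1 (a, j.2)‖ ^ 2)) := by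
            gcongr with j
            exact norm_chanOut_sq_le h j.1 _
        _ = 2 * ∑ j, ‖q.2 j‖ ^ 2 + 2 * (Hsq * ∑ i, ‖q.1 i‖ ^ 2) := by
            rw [Finset.sum_add_distrib, ← Finset.mul_sum, ← Finset.mul_sum]
            congr 2
            rw [Fintype.sum_prod_type, hHsq, Finset.sum_mul]
            refine Finset.sum_congr rfl fun k _ => ?_
            dsimp only
            rw [← Finset.mul_sum, Fintype.sum_prod_type, Finset.sum_comm]
        _ ≤ 2 * (8 * (((K₁ + K₂ : ℕ) : ℝ) * n)) + 2 * (Hsq * (8 * (L * n))) := by gcongr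
        _ = n * (16 * ((K₁ + K₂ : ℕ) : ℝ) + 1 * (16 * L * Hsq)) := by ring
        _ ≤ n * (16 * ((K₁ + K₂ : ℕ) : ℝ) + ((K₁ + K₂ : ℕ) : ℝ) * (16 * L * Hsq)) := by gcongr
        _ = _ := by ring
  -- libraries with the same bits outside `𝒰`
  let side : Library N B → ({p // p ∉ 𝒰} → Bool) := fun W p => W p.1.1 p.1.2
  have hupper : ∑ W ∈ G, (μ₁.prod μ₂).real (F W)ᶜ
      ≤ Fintype.card ({p // p ∉ 𝒰} → Bool) * V := by
    rw [← Finset.sum_fiberwise G side]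
    have h1 : ∀ σ, ∑ W ∈ G with side W = σ, (μ₁.prod μ₂).real (F W)ᶜ ≤ V := by
      intro σ
      rw [← ENNReal.ofReal_le_ofReal_iff hV0, ENNReal.ofReal_sum_of_nonneg fun _ _ => measureReal_nonneg]
      refine (Finset.sum_le_sum fun W _ => hDvol W).trans ?_
      rw [← measure_biUnion_finset _ fun W _ => hDmeas W]
      · refine (measure_mono ?_).trans hvol
        intro p hp
        obtain ⟨W, hW, hpW⟩ := Set.mem_iUnion₂.1 hp
        exact hDR W (Finset.mem_filter.1 hW).1 hpW
      · intro W hW W' hW' hne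
        have hW := (Finset.mem_filter.1 hW).2
        have hW' := (Finset.mem_filter.1 hW').2
        rw [Function.onFun, Set.disjoint_left]
        intro p hp hp'
        obtain ⟨k, hk1, hk2⟩ := hdet W W' hne fun p hp => congrFun (hW.trans hW'.symm) ⟨p, hp⟩
        have h1 := (hmemD W p hp).2.2 k
        have h2 := (hmemD W' p hp').2.2 k
        rw [hk1, h2] at h1
        exact hk2 h1.symm
    refine (Finset.sum_le_sum fun σ _ => h1 σ).trans ?_
    rw [Finset.sum_const, Finset.card_univ, nsmul_eq_mul]
  have hcards : M = 2 ^ 𝒰.card * (Fintype.card ({p // p ∉ 𝒰} → Bool) : ℝ) := by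
    have h1 : Fintype.card (Library N B) = 2 ^ 𝒰.card * Fintype.card ({p // p ∉ 𝒰} → Bool) := by
      have h3 : 𝒰.card + (N * B - 𝒰.card) = N * B := by
        apply Nat.add_sub_cancel'
        simpa using Finset.card_le_univ 𝒰
      have h2 : Fintype.card {p // p ∉ 𝒰} = N * B - 𝒰.card := by
        rw [Fintype.card_subtype_compl]
        simp
      have h4 : Fintype.card (Library N B) = 2 ^ (N * B) := by
        simp [Library, ← pow_mul, mul_comm]
      rw [h4, Fintype.card_fun, Fintype.card_bool, h2, ← pow_add, h3]
    rw [hM, h1]; push_cast; rfl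
  have hCpos : (0 : ℝ) < Fintype.card ({p // p ∉ 𝒰} → Bool) := by exact_mod_cast Fintype.card_pos
  have := hlower.trans hupper
  rw [hcards] at this
  refine le_of_mul_le_mul_right ?_ hCpos
  linarith

/-- If for every placement some demand leaves at least `β B` bits that must be delivered, then the delay
is at least `β / L`. -/
theorem AchievableWith.le_mul {L K₁ K₂ N : ℕ} {γ₁ T : ℝ}
    {adm : ∀ B, Set (Placement K₁ K₂ γ₁ N B)} {h : Channel L K₁ K₂}
    (hach : AchievableWith γ₁ N adm {h} T) (hL : 1 ≤ L) (hK : 1 ≤ K₁ + K₂) (β : ℝ)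
    (hdet : ∀ B, ∀ Z ∈ adm B, ∃ d : User K₁ K₂ → Fin N, Function.Injective d ∧
      ∃ 𝒰 : Finset (Fin N × Fin B), β * B ≤ 𝒰.card ∧
      ∀ W W' : Library N B, W ≠ W' → (∀ p ∉ 𝒰, W p.1 p.2 = W' p.1 p.2) →
        ∃ k, Z.content k W = Z.content k W' ∧ W (d k) ≠ W' (d k)) :
    β ≤ L * T := by
  by_contra hlt
  rw [not_le] at hlt
  obtain ⟨η, hη⟩ : ∃ η, η = β - L * T := ⟨_, rfl⟩
  have hη0 : 0 < η := by linarith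
  have hL' : (0 : ℝ) < L := by exact_mod_cast hL
  set δ := η / (4 * L) with hδ
  have hδ0 : 0 < δ := by positivity
  have hLδ : L * δ = η / 4 := by rw [hδ]; field_simp
  obtain ⟨Z, hZ, hach'⟩ := hach δ hδ0
  set Hsq := ∑ k, ∑ a, ‖h k a‖ ^ 2 with hHsq
  have hHsq0 : 0 ≤ Hsq := by positivity
  set C₁ := Real.pi * Real.exp 1 * 24 with hC₁
  set C₂ := Real.pi * Real.exp 1 * (16 + 16 * L * Hsq) with hC₂
  have hpe : 1 ≤ Real.pi * Real.exp 1 := by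
    have h1 := Real.pi_gt_three
    have h2 : 1 ≤ Real.exp 1 := Real.one_le_exp (by norm_num)
    nlinarith
  have hC₁1 : 1 ≤ C₁ := by rw [hC₁]; linarith
  have hC₂1 : 1 ≤ C₂ := by
    have : 0 ≤ 16 * L * Hsq := by positivity
    rw [hC₂]; nlinarith
  set C := L * Real.logb 2 C₁ + ((K₁ + K₂ : ℕ) : ℝ) * Real.logb 2 C₂ with hC
  have hC0 : 0 ≤ C := by
    have h1 : 0 ≤ Real.logb 2 C₁ := Real.logb_nonneg (by norm_num) hC₁1
    have h2 : 0 ≤ Real.logb 2 C₂ := Real.logb_nonneg (by norm_num) hC₂1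
    positivity
  have hlog : Tendsto (fun P : ℝ => Real.logb 2 P) atTop atTop :=
    Real.tendsto_logb_atTop (by norm_num)
  have hdiv : Tendsto (fun P : ℝ => (T + δ) * C / Real.logb 2 P) atTop (nhds 0) :=
    hlog.const_div_atTop _
  obtain ⟨P, ⟨hP, hPdiv⟩, hP1⟩ := (((hach' h rfl).and (hdiv.eventually_lt_const
    (show 0 < η / 4 by positivity))).and (eventually_gt_atTop 1)).exists
  have hKpos : (0 : ℝ) < ((K₁ + K₂ : ℕ) : ℝ) := by exact_mod_cast hK
  have hfreq := hP (1 / (4 * ((K₁ + K₂ : ℕ) : ℝ))) (by positivity)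
  rw [frequently_atTop] at hfreq
  obtain ⟨B₀, hB₀⟩ := exists_nat_gt (8 / η)
  obtain ⟨B, hB, hcode⟩ := hfreq B₀
  obtain ⟨d, hd, 𝒰, h𝒰, hdet'⟩ := hdet B (Z P B) (hZ P B)
  obtain ⟨n, c, hn, hen, herr⟩ := hcode d hd
  have hbound := c.two_pow_card_le h d hL hK hP1.le hen (by field_simp; norm_num) herr 𝒰 hdet'
  set x := Real.logb 2 P with hx
  have hx0 : 0 < x := Real.logb_pos (by norm_num) hP1
  have hP0 : 0 < P := by linarith
  have hC₁0 : 0 < C₁ := by linarith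
  have hC₂0 : 0 < C₂ := by linarith
  have hbits : (𝒰.card : ℝ) ≤ 2 + n * (L * x + C) := by
    have h1 : Real.pi * Real.exp 1 * (24 * P) = C₁ * P := by rw [hC₁]; ring
    rw [h1] at hbound
    have h2 := Real.logb_le_logb_of_le (b := 2) (by norm_num) (by positivity) hbound
    rw [Real.logb_pow, Real.logb_self_eq_one (by norm_num), mul_one, Real.logb_mul (by norm_num)
      (by positivity), Real.logb_mul (by positivity) (by positivity), Real.logb_pow, Real.logb_pow,
      Real.logb_mul hC₁0.ne' hP0.ne', ← hx] at h2
    have h4 : Real.logb 2 4 = 2 := by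
      rw [show (4 : ℝ) = 2 ^ (2 : ℕ) by norm_num, Real.logb_pow, Real.logb_self_eq_one (by norm_num)]
      norm_num
    rw [h4] at h2
    refine h2.trans (le_of_eq ?_)
    rw [hC]; push_cast; ring
  have hBB : 8 / η < (B : ℝ) := lt_of_lt_of_le hB₀ (by exact_mod_cast hB)
  have hB0 : (0 : ℝ) < B := lt_trans (by positivity) hBB
  rw [div_lt_iff₀ hη0] at hBB
  have hnC : (n : ℝ) * C ≤ (T + δ) * C / x * B := by
    rw [div_mul_eq_mul_div, le_div_iff₀ hx0]
    have := mul_le_mul_of_nonneg_right hn hC0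
    linarith
  have hnC' : (n : ℝ) * C ≤ η / 4 * B := hnC.trans (mul_le_mul_of_nonneg_right hPdiv.le hB0.le)
  have hnL : (n : ℝ) * (L * x) ≤ L * T * B + η / 4 * B := by
    have := mul_le_mul_of_nonneg_left hn hL'.le
    calc (n : ℝ) * (L * x) = L * (n * x) := by ring
      _ ≤ L * ((T + δ) * B) := this
      _ = L * T * B + (L * δ) * B := by ring
      _ = _ := by rw [hLδ]
  have hβ : β = η + L * T := by rw [hη]; ring
  rw [hβ] at h𝒰
  nlinarith

/-- The cut-set bound: the cache-less users need all their files through `L` antennas. -/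
theorem Achievable.card_cacheless_le {L K₁ K₂ N : ℕ} {γ₁ T : ℝ} {h : Channel L K₁ K₂} (hL : 1 ≤ L)
    (hK₁ : 1 ≤ K₁) (hN : K₁ + K₂ ≤ N) (hach : Achievable γ₁ N {h} T) : (K₂ : ℝ) ≤ L * T := by
  classical
  refine AchievableWith.le_mul hach hL (by omega) K₂ fun B Z _ => ?_
  obtain ⟨dd, hdd, -⟩ := exists_balanced_demands hN (by omega)
  set d := dd ⟨0, by omega⟩ with hd
  have hdinj : Function.Injective d := hdd _
  refine ⟨d, hdinj, (Finset.univ.image fun j : Fin K₂ => d (Sum.inr j)) ×ˢ Finset.univ, ?_, ?_⟩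
  · rw [Finset.card_product, Finset.card_image_of_injective (f := fun j => d (Sum.inr j)) _
      (hdinj.comp Sum.inr_injective)]
    simp
  · intro W W' hne hagree
    obtain ⟨m, hm⟩ := Function.ne_iff.1 hne
    obtain ⟨f, hf⟩ := Function.ne_iff.1 hm
    have hmem : (m, f) ∈ (Finset.univ.image fun j : Fin K₂ => d (Sum.inr j)) ×ˢ
        (Finset.univ : Finset (Fin B)) := by
      by_contra hn
      exact hf (hagree _ hn)
    obtain ⟨j, -, hj⟩ := Finset.mem_image.1 (Finset.mem_product.1 hmem).1
    refine ⟨Sum.inr j, ?_, ?_⟩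
    · have h1 := Z.size_le (Sum.inr j)
      have h2 : Z.size (Sum.inr j) = 0 := by
        simp only [cacheFraction, Sum.elim_inr, zero_mul] at h1
        exact_mod_cast le_antisymm h1 (Nat.cast_nonneg _)
      ext i
      exact absurd i.2 (by omega)
    · rw [hj]; exact hm

/-- Among the permutations, the fraction of those that put `u` before all elements of `A` is
`1 / (|A| + 1)`. -/
theorem factorial_le_card_perm_first {K : ℕ} (A : Finset (Fin K)) (u : Fin K) (hu : u ∉ A) :
    K.factorial ≤ (A.card + 1) *
      (Finset.univ.filter fun σ : Equiv.Perm (Fin K) => ∀ v ∈ A, σ u < σ v).card := by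
  classical
  let first : Fin K → Finset (Equiv.Perm (Fin K)) := fun w =>
    Finset.univ.filter fun σ => ∀ v ∈ insert u A, σ w ≤ σ v
  have hcover : (Finset.univ : Finset (Equiv.Perm (Fin K))) ⊆ (insert u A).biUnion first := by
    intro σ _
    obtain ⟨w, hw, hmin⟩ := Finset.exists_min_image (insert u A) σ ⟨u, Finset.mem_insert_self _ _⟩
    exact Finset.mem_biUnion.2 ⟨w, hw, Finset.mem_filter.2 ⟨Finset.mem_univ _, hmin⟩⟩
  have hswap : ∀ w ∈ insert u A, (first w).card ≤ (first u).card := by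
    intro w hw
    refine Finset.card_le_card_of_injOn (fun σ => σ * Equiv.swap u w) ?_
      fun a _ b _ hab => mul_right_cancel hab
    intro σ hσ
    have hσ' := (Finset.mem_filter.1 hσ).2
    refine Finset.mem_filter.2 ⟨Finset.mem_univ _, fun v hv => ?_⟩
    simp only [Equiv.Perm.mul_apply, Equiv.swap_apply_left]
    apply hσ'
    by_cases h1 : v = u
    · subst h1; simpa using hw
    · by_cases h2 : v = w
      · subst h2; simp
      · rwa [Equiv.swap_apply_of_ne_of_ne h1 h2]
  have hfirst : first u ⊆ Finset.univ.filter fun σ : Equiv.Perm (Fin K) => ∀ v ∈ A, σ u < σ v := by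
    intro σ hσ
    refine Finset.mem_filter.2 ⟨Finset.mem_univ _, fun v hv => ?_⟩
    refine lt_of_le_of_ne ((Finset.mem_filter.1 hσ).2 v (Finset.mem_insert_of_mem hv)) fun he => ?_
    exact hu (σ.injective he ▸ hv)
  calc K.factorial = (Finset.univ : Finset (Equiv.Perm (Fin K))).card := by
        rw [Finset.card_univ, Fintype.card_perm, Fintype.card_fin]
    _ ≤ ∑ w ∈ insert u A, (first w).card :=
        (Finset.card_le_card hcover).trans Finset.card_biUnion_le
    _ ≤ ∑ w ∈ insert u A, (first u).card := Finset.sum_le_sum hswap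
    _ = (A.card + 1) * (first u).card := by
        rw [Finset.sum_const, smul_eq_mul, Finset.card_insert_of_notMem hu]
    _ ≤ _ := Nat.mul_le_mul_left _ (Finset.card_le_card hfirst)

/-- With uncoded placement, `L` antennas reduce the single-antenna delay at most by the factor `L`. The
cache-aided users decode in the order of a permutation `σ`, each with the help of the files decoded
before; a requested bit has to be delivered if no user up to the one that requests it has it in its cache.
On average over the permutations and the demands, `1 / (a + 1)` of the requests of a bit cached at
`a` users, by the other users, are of this kind. -/
theorem UncodedAchievable.singleStreamDelay_le {L K₁ K₂ N t : ℕ} {γ₁ T : ℝ} {h : Channel L K₁ K₂}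
    (hL : 1 ≤ L) (hK₁ : 1 ≤ K₁) (hN : K₁ + K₂ ≤ N) (ht : (K₁ : ℝ) * γ₁ = t)
    (hach : UncodedAchievable γ₁ N {h} T) : singleStreamDelay K₁ γ₁ ≤ L * T := by
  classical
  rw [singleStreamDelay_eq ht]
  refine AchievableWith.le_mul hach hL (by omega) _ fun B Z hZ => ?_
  obtain ⟨dd, hdd, hdd'⟩ := exists_balanced_demands hN (by omega)
  choose pos hpos using (hZ : Z.IsUncoded)
  let cached : Fin K₁ → Finset (Fin N × Fin B) := fun v => Finset.univ.image (pos (Sum.inl v))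
  let A : Fin N × Fin B → Finset (Fin K₁) := fun p => Finset.univ.filter fun v => p ∈ cached v
  let Q : Fin N → Equiv.Perm (Fin K₁) → Fin K₁ → Finset (Fin N × Fin B) := fun c σ u =>
    Finset.univ.filter fun p => dd c (Sum.inl u) = p.1 ∧ u ∉ A p ∧ ∀ v ∈ A p, σ u < σ v
  let 𝒰 : Fin N → Equiv.Perm (Fin K₁) → Finset (Fin N × Fin B) := fun c σ => Finset.univ.biUnion (Q c σ)
  have hdet : ∀ c σ, ∀ W W' : Library N B, W ≠ W' →
      (∀ p ∉ 𝒰 c σ, W p.1 p.2 = W' p.1 p.2) →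
      ∃ k, Z.content k W = Z.content k W' ∧ W (dd c k) ≠ W' (dd c k) := by
    intro c σ W W' hne hagree
    -- the first user in the order of `σ` whose requested file differs
    have hex : (Finset.univ.filter fun u : Fin K₁ =>
        W (dd c (Sum.inl u)) ≠ W' (dd c (Sum.inl u))).Nonempty := by
      obtain ⟨m, hm⟩ := Function.ne_iff.1 hne
      obtain ⟨f, hf⟩ := Function.ne_iff.1 hm
      have hmem : (m, f) ∈ 𝒰 c σ := by
        by_contra hn
        exact hf (hagree _ hn)
      obtain ⟨u, -, hu⟩ := Finset.mem_biUnion.1 hmem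
      have := (Finset.mem_filter.1 hu).2.1
      exact ⟨u, Finset.mem_filter.2 ⟨Finset.mem_univ _, by rw [this]; exact hm⟩⟩
    obtain ⟨u, hu, hmin⟩ := Finset.exists_min_image _ σ hex
    refine ⟨Sum.inl u, ?_, (Finset.mem_filter.1 hu).2⟩
    ext i
    rw [hpos, hpos]
    set p := pos (Sum.inl u) i with hp
    have hpc : u ∈ A p := Finset.mem_filter.2 ⟨Finset.mem_univ _, Finset.mem_image_of_mem _ (Finset.mem_univ i)⟩
    by_cases hpU : p ∈ 𝒰 c σ
    · obtain ⟨v, -, hv⟩ := Finset.mem_biUnion.1 hpU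
      obtain ⟨hv1, -, hv2⟩ := (Finset.mem_filter.1 hv).2
      have hlt := hv2 u hpc
      have heq : W (dd c (Sum.inl v)) = W' (dd c (Sum.inl v)) := by
        by_contra hn
        exact absurd (hmin v (Finset.mem_filter.2 ⟨Finset.mem_univ _, hn⟩)) (not_le.2 hlt)
      rw [hv1] at heq
      rw [heq]
    · rw [hagree p hpU]
  have hcard𝒰 : ∀ c σ, (𝒰 c σ).card = ∑ u, (Q c σ u).card := by
    intro c σ
    refine Finset.card_biUnion fun u _ v _ huv => ?_
    rw [Function.onFun, Finset.disjoint_left]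
    intro p hp hp'
    have h1 := (Finset.mem_filter.1 hp).2.1
    have h2 := (Finset.mem_filter.1 hp').2.1
    exact huv (Sum.inl_injective (hdd c (h1.trans h2.symm)))
  have hcount : ∑ c, ∑ σ, ((𝒰 c σ).card : ℝ)
      = ∑ p, ∑ u ∈ Finset.univ \ A p,
        ((Finset.univ.filter fun σ : Equiv.Perm (Fin K₁) => ∀ v ∈ A p, σ u < σ v).card : ℝ) := by
    have h1 : ∀ c σ, ((𝒰 c σ).card : ℝ) = ∑ u, ∑ p, if dd c (Sum.inl u) = p.1 then
        (if u ∉ A p ∧ ∀ v ∈ A p, σ u < σ v then (1 : ℝ) else 0) else 0 := by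
      intro c σ
      rw [hcard𝒰]
      push_cast
      refine Finset.sum_congr rfl fun u _ => ?_
      rw [Finset.card_filter]
      push_cast
      exact Finset.sum_congr rfl fun p _ => by rw [ite_and]
    simp_rw [h1]
    rw [Finset.sum_comm]
    have h2 : ∀ σ : Equiv.Perm (Fin K₁), ∑ c, ∑ u, ∑ p, (if dd c (Sum.inl u) = p.1 then
        (if u ∉ A p ∧ ∀ v ∈ A p, σ u < σ v then (1 : ℝ) else 0) else 0)
        = ∑ p, ∑ u, if u ∉ A p ∧ ∀ v ∈ A p, σ u < σ v then (1 : ℝ) else 0 := by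
      intro σ
      rw [Finset.sum_comm, Finset.sum_comm (s := (Finset.univ : Finset (Fin N × Fin B)))]
      refine Finset.sum_congr rfl fun u _ => ?_
      rw [Finset.sum_comm]
      refine Finset.sum_congr rfl fun p _ => ?_
      obtain ⟨c, hc⟩ := (hdd' (Sum.inl u)).2 p.1
      rw [Finset.sum_eq_single c]
      · exact if_pos hc
      · intro c' _ hne
        refine if_neg fun hc' => hne ((hdd' (Sum.inl u)).1 (hc'.trans hc.symm))
      · simp
    rw [Finset.sum_congr rfl fun σ _ => h2 σ, Finset.sum_comm]
    refine Finset.sum_congr rfl fun p _ => ?_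
    rw [Finset.sum_comm, ← Finset.sum_subset (Finset.subset_univ (Finset.univ \ A p))]
    · refine Finset.sum_congr rfl fun u hu => ?_
      have hu' := (Finset.mem_sdiff.1 hu).2
      rw [Finset.card_filter]
      push_cast
      exact Finset.sum_congr rfl fun σ _ => by simp only [hu', not_false_eq_true, true_and]
    · intro u _ hu
      have hu' : u ∈ A p := by simpa using hu
      simp [hu']
  have hfac : (0 : ℝ) < K₁.factorial := by exact_mod_cast K₁.factorial_pos
  have hper : ∀ p, (K₁.factorial : ℝ) * (((K₁ : ℝ) - (A p).card) / (1 + (A p).card))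
      ≤ ∑ u ∈ Finset.univ \ A p,
        ((Finset.univ.filter fun σ : Equiv.Perm (Fin K₁) => ∀ v ∈ A p, σ u < σ v).card : ℝ) := by
    intro p
    have h1 : ∀ u ∈ Finset.univ \ A p, (K₁.factorial : ℝ) / (1 + (A p).card) ≤
        ((Finset.univ.filter fun σ : Equiv.Perm (Fin K₁) => ∀ v ∈ A p, σ u < σ v).card : ℝ) := by
      intro u hu
      rw [div_le_iff₀ (by positivity)]
      have := factorial_le_card_perm_first (A p) u (Finset.mem_sdiff.1 hu).2
      have h2 : (K₁.factorial : ℝ) ≤ ((A p).card + 1) *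
        ((Finset.univ.filter fun σ : Equiv.Perm (Fin K₁) => ∀ v ∈ A p, σ u < σ v).card : ℝ) := by
        exact_mod_cast this
      linarith
    refine le_trans (le_of_eq ?_) (Finset.sum_le_sum h1)
    rw [Finset.sum_const, nsmul_eq_mul]
    have h2 : ((Finset.univ \ A p).card : ℝ) = K₁ - (A p).card := by
      rw [Finset.card_sdiff_of_subset (Finset.subset_univ _), 
        Nat.cast_sub (Finset.card_le_card (Finset.subset_univ _))]
      simp
    rw [h2]; ring
  have hsumA : ∑ p, ((A p).card : ℝ) ≤ t * Fintype.card (Fin N × Fin B) := by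
    have h1 : ∑ p, ((A p).card : ℝ) = ∑ v, ((cached v).card : ℝ) := by
      rw [← Nat.cast_sum, ← Nat.cast_sum]
      congr 1
      simp only [A, Finset.card_filter]
      rw [Finset.sum_comm]
      refine Finset.sum_congr rfl fun v _ => ?_
      rw [← Finset.card_filter]; simp
    have h2 : ∀ v, ((cached v).card : ℝ) ≤ γ₁ * N * B := by
      intro v
      refine le_trans ?_ (Z.size_le (Sum.inl v))
      have : (cached v).card ≤ Z.size (Sum.inl v) := Finset.card_image_le.trans (by simp)
      exact_mod_cast this
    rw [h1]
    refine (Finset.sum_le_sum fun v _ => h2 v).trans (le_of_eq ?_)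
    rw [Finset.sum_const, Finset.card_univ, Fintype.card_fin, nsmul_eq_mul, ← ht]
    simp; ring
  have hconv := card_mul_div_le_sum (fun p => ((A p).card : ℝ)) (fun p => Nat.cast_nonneg _)
    (K := K₁) (l := 1) (t := t) (Nat.cast_nonneg _) one_pos (Nat.cast_nonneg _) hsumA
  have htotal : ∑ x : Fin N × Equiv.Perm (Fin K₁), ((K₁ : ℝ) - t) / (1 + t) * B
      ≤ ∑ x : Fin N × Equiv.Perm (Fin K₁), ((𝒰 x.1 x.2).card : ℝ) := by
    rw [Fintype.sum_prod_type (fun x : Fin N × Equiv.Perm (Fin K₁) => ((𝒰 x.1 x.2).card : ℝ)), hcount]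
    refine le_trans ?_ (Finset.sum_le_sum fun p _ => hper p)
    have hconv' := mul_le_mul_of_nonneg_left hconv hfac.le
    rw [Finset.mul_sum] at hconv'
    refine le_trans (le_of_eq ?_) hconv'
    rw [Finset.sum_const, Finset.card_univ, nsmul_eq_mul, Fintype.card_prod, Fintype.card_prod,
      Fintype.card_perm, Fintype.card_fin, Fintype.card_fin, Fintype.card_fin]
    push_cast
    ring
  have : NeZero N := ⟨by omega⟩
  obtain ⟨⟨c, σ⟩, -, hx⟩ := Finset.exists_le_of_sum_le Finset.univ_nonempty htotal
  exact ⟨dd c, hdd c, 𝒰 c σ, hx, hdet c σ⟩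

end CodedCaching

theorem theorem2 (L K₁ K₂ N t : ℕ) (γ₁ : ℝ) (hL : 1 ≤ L) (hK₁ : 1 ≤ K₁)
    (hγ₀ : 0 < γ₁) (hγ₁ : γ₁ < 1) (ht : (K₁ : ℝ) * γ₁ = t) (hN : K₁ + K₂ ≤ N) :
    -- many cache-less users
    (((L : ℝ) - 1) * singleStreamDelay K₁ γ₁ ≤ K₂ → L ≤ K₂ + 1 →
      LinearOneShotAchievable γ₁ N (genericChannels L K₁ K₂) (delayMany L K₁ K₂ γ₁) ∧
      UncodedAchievable γ₁ N (genericChannels L K₁ K₂) (delayMany L K₁ K₂ γ₁) ∧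
      Achievable γ₁ N (genericChannels L K₁ K₂) (delayMany L K₁ K₂ γ₁) ∧
      -- gap to the optimum over all schemes
      ((2 ≤ L ∨ singleStreamDelay K₁ γ₁ ≤ K₂) →
        ∀ h ∈ genericChannels L K₁ K₂, ∀ T : ℝ, Achievable γ₁ N {h} T →
          delayMany L K₁ K₂ γ₁ ≤ 2 * T) ∧
      -- gap to the optimum over all schemes with uncoded placement
      (∀ h ∈ genericChannels L K₁ K₂, ∀ T : ℝ, UncodedAchievable γ₁ N {h} T →
        delayMany L K₁ K₂ γ₁ ≤ 2 * T)) ∧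
    -- few cache-less users
    ((K₂ : ℝ) ≤ ((L : ℝ) - 1) * singleStreamDelay K₁ γ₁ →
      (L + 2 * t ≤ K₁ + K₂ ∨ (K₂ = 0 ∧ L + t ≤ K₁)) →
      LinearOneShotAchievable γ₁ N (genericChannels L K₁ K₂) (delayFew L K₁ K₂ γ₁) ∧
      UncodedAchievable γ₁ N (genericChannels L K₁ K₂) (delayFew L K₁ K₂ γ₁) ∧
      Achievable γ₁ N (genericChannels L K₁ K₂) (delayFew L K₁ K₂ γ₁) ∧
      -- gap to the optimum over linear one-shot schemes
      (∀ h ∈ genericChannels L K₁ K₂, ∀ T : ℝ, LinearOneShotAchievable γ₁ N {h} T →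
        delayFew L K₁ K₂ γ₁ ≤ 3 * T)) := by
  have hK₁' : (0 : ℝ) < K₁ := by exact_mod_cast hK₁
  have hL' : (1 : ℝ) ≤ L := by exact_mod_cast hL
  have htK : t < K₁ := by
    have : (t : ℝ) < K₁ := by rw [← ht]; nlinarith
    exact_mod_cast this
  have hS0 : 0 < singleStreamDelay K₁ γ₁ := by
    rw [singleStreamDelay_eq ht]
    have : (t : ℝ) < K₁ := by exact_mod_cast htK
    exact div_pos (by linarith) (by positivity)
  have hfew0 : 0 ≤ delayFew L K₁ K₂ γ₁ := by
    rw [delayFew]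
    have : 0 ≤ 1 - γ₁ := by linarith
    positivity
  refine ⟨fun h1 h2 => ?_, fun h1 h2 => ?_⟩
  · have hmany0 : 0 ≤ delayMany L K₁ K₂ γ₁ := by
      rw [delayMany]
      exact add_nonneg hS0.le (div_nonneg (by linarith) (by positivity))
    have hlin := linearOneShotAchievable_delayMany (N := N) hL htK ht h1 h2
    have hunc := hlin.uncodedAchievable hγ₀.le hmany0
    -- with `K₂ = L - 1` the delay is `1`, with more cache-less users they are served `L` at a time
    have hdelay : 0 < K₂ → singleStreamDelay K₁ γ₁ ≤ K₂ →
        L * delayMany L K₁ K₂ γ₁ ≤ 2 * K₂ := by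
      intro hK₂ hS
      have hK₂' : (1 : ℝ) ≤ K₂ := by exact_mod_cast hK₂
      rcases le_or_gt L K₂ with hLK | hLK
      · have : (L : ℝ) ≤ K₂ := by exact_mod_cast hLK
        rw [delayMany, min_eq_left this, mul_add, mul_div_cancel₀ _ (by positivity)]
        linarith
      · have hLe : (L : ℝ) = K₂ + 1 := by exact_mod_cast (by omega : L = K₂ + 1)
        rw [delayMany, min_eq_right (by linarith), hLe, add_sub_cancel_right, sub_div,
          div_self (by positivity), mul_div_cancel_left₀ _ (by positivity)]
        linarith
    have hgap : 0 < K₂ → singleStreamDelay K₁ γ₁ ≤ K₂ → ∀ h : Channel L K₁ K₂, ∀ T : ℝ,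
        Achievable γ₁ N {h} T → delayMany L K₁ K₂ γ₁ ≤ 2 * T := by
      intro hK₂ hS h T hT
      have h3 := hT.card_cacheless_le hL hK₁ hN
      have h4 := hdelay hK₂ hS
      refine le_of_mul_le_mul_left ?_ (by linarith : (0 : ℝ) < L)
      linarith
    have hbranch : 2 ≤ L ∨ singleStreamDelay K₁ γ₁ ≤ K₂ →
        0 < K₂ ∧ singleStreamDelay K₁ γ₁ ≤ K₂ := by
      intro h3
      have h4 : singleStreamDelay K₁ γ₁ ≤ K₂ := by
        rcases h3 with h3 | h3
        · have : (2 : ℝ) ≤ L := by exact_mod_cast h3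
          nlinarith
        · exact h3
      exact ⟨by exact_mod_cast hS0.trans_le h4, h4⟩
    refine ⟨hlin, hunc, hunc.achievable, fun h3 h _ T hT => ?_, fun h _ T hT => ?_⟩
    · exact hgap (hbranch h3).1 (hbranch h3).2 h T hT
    · by_cases h3 : 2 ≤ L ∨ singleStreamDelay K₁ γ₁ ≤ K₂
      · exact hgap (hbranch h3).1 (hbranch h3).2 h T hT.achievable
      · rw [not_or, not_le, not_le] at h3
        obtain rfl : L = 1 := by omega
        have h4 := hT.singleStreamDelay_le hL hK₁ hN ht
        -- for `K₂ = 0` the fraction in the delay is `0 / 0 = 0`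
        have h5 : delayMany 1 K₁ K₂ γ₁ = singleStreamDelay K₁ γ₁ + K₂ := by
          rcases Nat.eq_zero_or_pos K₂ with h6 | h6
          · subst h6; simp [delayMany]
          · have : (1 : ℝ) ≤ K₂ := by exact_mod_cast h6
            simp [delayMany, this]
        rw [h5]
        have := h3.2
        rw [Nat.cast_one, one_mul] at h4
        linarith
  · have hlin := linearOneShotAchievable_delayFew (N := N) hL htK ht h1 h2
    have hunc := hlin.uncodedAchievable hγ₀.le hfew0
    refine ⟨hlin, hunc, hunc.achievable, fun h hh T hT => ?_⟩
    have := delayFew_le_of_linearOneShotAchievable hL hK₁ ht hN hh hT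
    linarith
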